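/- Let $1\le S\le N$, $\sigma>0$, and let $\mathcal X_S=\{\mathbf x\in\mathbb R^N:\|\mathbf x\|_0\le S\}$ be the set of vectors with at most $S$ nonzero entries. Consider the sparse signal in noise model (SSNM): for $\mathbf x\in\mathcal X_S$ one observes $\mathbf y=\mathbf x+\mathbf n\in\mathbb R^N$ with $\mathbf n\sim\mathcal N(\mathbf 0,\sigma^2\mathbf I)$; $\mathsf E_{\mathbf x}$ denotes expectation under this law of $\mathbf y$. Let $g:\mathcal X_S\to\mathbb R$ be a parameter function, $c:\mathcal X_S\to\mathbb R$ a prescribed bias function, $\gamma=c+g$, and $\mathbf x_0\in\mathcal X_S$. Let $\mathcal A$ be the set of (measurable) estimators $\hat g:\mathbb R^N\to\mathbb R$ that have finite variance at $\mathbf x_0$ and satisfy $\mathsf E_{\mathbf x}\{\hat g(\mathbf y)\}-g(\mathbf x)=c(\mathbf x)$ for all $\mathbf x\in\mathcal X_S$. The bias function $c$ is called valid at $\mathbf x_0$ if $\mathcal A\neq\emptyset$; the minimum achievable variance (Barankin bound) is $M(c,\mathbf x_0)=\inf_{\hat g\in\mathcal A}\operatorname{Var}_{\mathbf x_0}(\hat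 g(\mathbf y))$ (and $\infty$ if $\mathcal A=\emptyset$); an LMV estimator is a $\hat g\in\mathcal A$ that attains this infimum. For a multi-index $\mathbf p\in\mathbb Z_+^N$ write $\mathbf p!=\prod_l p_l!$, $\mathbf x^{\mathbf p}=\prod_l x_l^{p_l}$, and $\partial^{\mathbf p}/\partial\mathbf x^{\mathbf p}$ for the corresponding mixed partial derivative. Put $$\nu_{\mathbf x_0}(\mathbf x)=\exp\Big(-\frac{\|\mathbf x_0\|_2^2}{2\sigma^2}+\frac{\mathbf x^T\mathbf x_0}{\sigma^2}\Big),\qquad \psi_{\mathbf x_0}(\mathbf x,\mathbf y)=\exp\Big(\frac{\mathbf y^T(\sigma\mathbf x-\mathbf x_0)}{\sigma^2}+\frac{\mathbf x_0^T\mathbf x}{\sigma}-\frac{\|\mathbf x\|_2^2}{2}\Big).$$ 1. The bias function $c$ is valid at $\mathbf x_0$ if and only if there is a coefficient sequence $a\in\ell^2(\mathbb Z_+^N\cap\mathcal X_S)$ such that $$\gamma(\mathbf x)=\frac{1}{\nu_{\mathbf x_0}(\mathbf x)}\sum_{\mathbf p\in\mathbb Z_+^N\cap\mathcal X_S}\frac{a[\mathbf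 p]}{\sqrt{\mathbf p!}}\Big(\frac{\mathbf x}{\sigma}\Big)^{\mathbf p},\qquad \mathbf x\in\mathcal X_S,$$ with an (absolutely) convergent series. This sequence is unique for a given $c$. 2. Suppose that $c$ is valid at $\mathbf x_0$. For $\mathbf p\in\mathbb Z_+^N\cap\mathcal X_S$ put $$a_{\mathbf x_0}[\mathbf p]=\frac{1}{\sqrt{\mathbf p!}}\,\frac{\partial^{\mathbf p}\big(\gamma(\sigma\mathbf x)\,\nu_{\mathbf x_0}(\sigma\mathbf x)\big)}{\partial\mathbf x^{\mathbf p}}\bigg|_{\mathbf x=\mathbf 0},$$ where only the values of $\gamma$ on the coordinate subspace $\{\mathbf x:\operatorname{supp}\mathbf x\subseteq\operatorname{supp}\mathbf p\}\subseteq\mathcal X_S$ enter. The function being differentiated is infinitely differentiable on this subspace. Moreover: (a) The squares $a_{\mathbf x_0}^2[\mathbf p]$ are summable and $$M(c,\mathbf x_0)=\sum_{\mathbf p\in\mathbb Z_+^N\cap\mathcal X_S}a_{\mathbf x_0}^2[\mathbf p]-\gamma^2(\mathbf x_0).$$ (b) The LMV estimator at $\mathbf x_0$ exists and is given by $$\hat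 g(\mathbf y)=\sum_{\mathbf p\in\mathbb Z_+^N\cap\mathcal X_S}\frac{a_{\mathbf x_0}[\mathbf p]}{\sqrt{\mathbf p!}}\,\frac{\partial^{\mathbf p}\psi_{\mathbf x_0}(\mathbf x,\mathbf y)}{\partial\mathbf x^{\mathbf p}}\bigg|_{\mathbf x=\mathbf 0},$$ where the series converges unconditionally in mean square with respect to the law of $\mathbf y$ at $\mathbf x_0$. That is, a measurable function $\hat g:\mathbb R^N\to\mathbb R$ is an LMV estimator at $\mathbf x_0$ if and only if the finite partial sums of the series converge to $\hat g$ in this sense. -/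

import Mathlib

open MeasureTheory ProbabilityTheory Filter Topology
open scoped ENNReal ContDiff

noncomputable section

namespace MVE

/-! ### Minimum variance estimation for a general statistical model

`P θ` is the law of the observation under the parameter value `θ`, `g` is the (scalar) parameter
function, `c` a prescribed bias function, `θ₀` a fixed parameter value. -/

variable {Θ Y : Type*} [MeasurableSpace Y]

/-- The allowed estimators at `θ₀`: finite variance at `θ₀`, and bias equal to `c` everywhere. -/
def allowedEstimators (P : Θ → Measure Y) (g c : Θ → ℝ) (θ₀ : Θ) : Set (Y → ℝ) :=
  {h | Measurable h ∧ evariance h (P θ₀) < ⊤ ∧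
    ∀ θ, Integrable h (P θ) ∧ (∫ y, h y ∂(P θ)) - g θ = c θ}

/-- The bias function `c` is valid at `θ₀`. -/
def IsValidBias (P : Θ → Measure Y) (g c : Θ → ℝ) (θ₀ : Θ) : Prop :=
  (allowedEstimators P g c θ₀).Nonempty

/-- The minimum achievable variance (Barankin bound) at `θ₀`; it is `∞` if `c` is not valid. -/
def minVariance (P : Θ → Measure Y) (g c : Θ → ℝ) (θ₀ : Θ) : ℝ≥0∞ :=
  ⨅ h ∈ allowedEstimators P g c θ₀, evariance h (P θ₀)

/-- `h` is a locally minimum variance (LMV) estimator at `θ₀` for the bias function `c`. -/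
def IsLMV (P : Θ → Measure Y) (g c : Θ → ℝ) (θ₀ : Θ) (h : Y → ℝ) : Prop :=
  h ∈ allowedEstimators P g c θ₀ ∧ evariance h (P θ₀) = minVariance P g c θ₀

end MVE

namespace SSNM

/-! ### Sparse vectors and multi-indices -/

/-- The set of `S`-sparse vectors in `ℝ^N`. -/
def sparseSet (N S : ℕ) : Set (EuclideanSpace ℝ (Fin N)) :=
  {x | (Finset.univ.filter fun i => x i ≠ 0).card ≤ S}

/-- The support of a multi-index. -/
def msupp {N : ℕ} (p : Fin N → ℕ) : Finset (Fin N) :=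
  Finset.univ.filter fun i => p i ≠ 0

/-- The multi-indices in `ℤ₊^N` that are `S`-sparse. -/
abbrev SparseIndex (N S : ℕ) : Type :=
  {p : Fin N → ℕ // (msupp p).card ≤ S}

/-- `p! = ∏ p_l!`. -/
def mfactorial {N : ℕ} (p : Fin N → ℕ) : ℝ :=
  ∏ i, ((p i).factorial : ℝ)

/-- `x^p = ∏ x_l^{p_l}`. -/
def mpow {N : ℕ} (x : EuclideanSpace ℝ (Fin N)) (p : Fin N → ℕ) : ℝ :=
  ∏ i, x i ^ p i

/-- `x^I`: all entries of `x` outside `I` are set to zero. -/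
def zeroOff {N : ℕ} (I : Finset (Fin N)) (x : EuclideanSpace ℝ (Fin N)) :
    EuclideanSpace ℝ (Fin N) :=
  WithLp.toLp 2 fun i => if i ∈ I then x i else 0

theorem smul_zeroOff_mem_sparseSet {N S : ℕ} {I : Finset (Fin N)} (hI : I.card ≤ S) (t : ℝ)
    (x : EuclideanSpace ℝ (Fin N)) : t • zeroOff I x ∈ sparseSet N S := by
  refine le_trans (Finset.card_le_card ?_) hI
  intro i hi
  by_contra h
  simp [zeroOff, h] at hi

/-! ### Partial derivatives -/

/-- The partial derivative in the `i`-th coordinate. -/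
def partialDeriv {N : ℕ} (i : Fin N) (f : EuclideanSpace ℝ (Fin N) → ℝ) :
    EuclideanSpace ℝ (Fin N) → ℝ :=
  fun x => lineDeriv ℝ f x (EuclideanSpace.single i 1)

/-- The mixed partial derivative `∂^p f`, i.e. `∂_1^{p_1} ⋯ ∂_N^{p_N} f`. -/
def multiDeriv {N : ℕ} (p : Fin N → ℕ) (f : EuclideanSpace ℝ (Fin N) → ℝ) :
    EuclideanSpace ℝ (Fin N) → ℝ :=
  (List.finRange N).foldr (fun i F => (partialDeriv i)^[p i] F) f

/-! ### The sparse signal in noise model -/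

/-- The pdf of the observation `y = x + n`, with `n ∼ N(0, σ² I)`. -/
def obsPdf {N : ℕ} (σ : ℝ) (x y : EuclideanSpace ℝ (Fin N)) : ℝ :=
  1 / (2 * Real.pi * σ ^ 2) ^ ((N : ℝ) / 2) * Real.exp (-(1 / (2 * σ ^ 2)) * ‖y - x‖ ^ 2)

/-- The statistical model: the law of the observation for each `S`-sparse parameter vector. -/
def model (N S : ℕ) (σ : ℝ) (x : sparseSet N S) : Measure (EuclideanSpace ℝ (Fin N)) :=
  volume.withDensity fun y => ENNReal.ofReal (obsPdf σ x.1 y)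

/-- The function `ν_{x₀}`. -/
def nu {N : ℕ} (σ : ℝ) (x₀ x : EuclideanSpace ℝ (Fin N)) : ℝ :=
  Real.exp (-(1 / (2 * σ ^ 2)) * ‖x₀‖ ^ 2 + 1 / σ ^ 2 * inner ℝ x x₀)

/-- The function `ψ_{x₀}`. -/
def psi {N : ℕ} (σ : ℝ) (x₀ x y : EuclideanSpace ℝ (Fin N)) : ℝ :=
  Real.exp (inner ℝ y (σ • x - x₀) / σ ^ 2 + inner ℝ x₀ x / σ - ‖x‖ ^ 2 / 2)

/-- `a` is a square-summable sequence indexed by the sparse multi-indices for which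
`γ(x) = ν_{x₀}(x)⁻¹ ∑_p a[p] / √p! (x/σ)^p`, with a convergent series, for all sparse `x`. -/
def IsCoeffSeq {N S : ℕ} (σ : ℝ) (x₀ : sparseSet N S) (γ : sparseSet N S → ℝ)
    (a : SparseIndex N S → ℝ) : Prop :=
  (Summable fun p => a p ^ 2) ∧
    ∀ x : sparseSet N S,
      (Summable fun p : SparseIndex N S =>
        a p / √(mfactorial p.1) * mpow (σ⁻¹ • x.1) p.1) ∧
      γ x = 1 / nu σ x₀.1 x.1 *
        ∑' p : SparseIndex N S, a p / √(mfactorial p.1) * mpow (σ⁻¹ • x.1) p.1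

/-- The function `x ↦ γ(σ x) ν_{x₀}(σ x)` on the coordinate subspace of vectors supported in
`supp p`, regarded as a function on `ℝ^N` that does not depend on the other coordinates. The
mean function `γ` is defined for sparse arguments only; since `p` is sparse, this is the part of
the function that `∂^p` at `0` refers to. -/
def scaledMean {N S : ℕ} (σ : ℝ) (x₀ : sparseSet N S) (γ : sparseSet N S → ℝ)
    (p : SparseIndex N S) (x : EuclideanSpace ℝ (Fin N)) : ℝ :=
  γ ⟨σ • zeroOff (msupp p.1) x, smul_zeroOff_mem_sparseSet p.2 σ x⟩ *
    nu σ x₀.1 (σ • zeroOff (msupp p.1) x)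

/-- The coefficients `a_{x₀}[p] = (p!)^{-1/2} ∂^p (γ(σ x) ν_{x₀}(σ x))` at `x = 0`. -/
def coeff {N S : ℕ} (σ : ℝ) (x₀ : sparseSet N S) (γ : sparseSet N S → ℝ)
    (p : SparseIndex N S) : ℝ :=
  1 / √(mfactorial p.1) * multiDeriv p.1 (scaledMean σ x₀ γ p) 0

/-- The `p`-th term `a_{x₀}[p] / √p! · ∂^p ψ_{x₀}(x, y)` at `x = 0` of the estimator series. -/
def lmvTerm {N S : ℕ} (σ : ℝ) (x₀ : sparseSet N S) (γ : sparseSet N S → ℝ)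
    (p : SparseIndex N S) (y : EuclideanSpace ℝ (Fin N)) : ℝ :=
  coeff σ x₀ γ p / √(mfactorial p.1) * multiDeriv p.1 (fun x => psi σ x₀.1 x y) 0

end SSNM

end

/-! Everything takes place in `L²` of the law at `x₀`. The likelihood ratio of the law at `x` to the
law at `x₀` is `ψ(x/σ, ·)/ν(x)`, so a square-integrable `h` has mean `γ` exactly when `⟨h, ψ(x/σ,
·)⟩ = γ(x) ν(x)` for all sparse `x`.

With `w = (y + x₀)/σ`, `ψ(x, y)` is `ψ(0, y)` times the generating function `∏ exp(wᵢxᵢ - xᵢ²/2)` of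
the Hermite polynomials. The weight `ψ(0, ·)²` turns the law at `x₀` into the law at `-x₀`, under
which `w` is standard normal. Hence the functions `e_p = ψ(0, ·) ∏ He_{pᵢ}(wᵢ)/√p!` are orthonormal,
and `⟨e_p, ψ(x, ·)⟩ = x^p/√p!` (`integral_hermiteSystem_mul`, `integral_hermiteSystem_mul_psi`).

For sparse `x` the monomial `x^p` vanishes unless `p` is sparse, and `∑ x^{2p}/p! = exp ‖x‖² = ‖ψ(x,
·)‖²`. Bessel's inequality is then an equality, so `ψ(x, ·)` is the sum of its expansion over sparse
`p` (`hasSum_psiLp`); completeness of the Hermite system plays no role. Consequently `h` is allowed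
iff its coefficients `⟨e_p, h⟩` represent `γ` (`mem_allowedEstimators_iff`).

Such coefficients are Taylor coefficients of `γ(σx) ν(σx)` on coordinate subspaces, hence unique
(`contDiff_scaledMean_and_coeff_eq`). All allowed estimators thus share the same `a`, their second
moment is at least `∑ a_p²`, and equality holds exactly for `∑ a_p e_p`. -/

namespace SSNM

/-! ### Mixed partial derivatives of products and monomials -/

section Calculus

variable {N : ℕ}

/-- If a family of functions indexed by multi-indices is closed under partial differentiation, in
the sense that `∂ᵢ` shifts the index by the `i`-th unit vector, then `∂^p` shifts it by `p`. -/
theorem multiDeriv_of_family (G : (Fin N → ℕ) → EuclideanSpace ℝ (Fin N) → ℝ)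
    (hG : ∀ m i, partialDeriv i (G m) = G (m + Pi.single i 1)) (p : Fin N → ℕ) :
    multiDeriv p (G 0) = G p := by
  have iter : ∀ (i : Fin N) (k : ℕ) (m : Fin N → ℕ),
      (partialDeriv i)^[k] (G m) = G (m + Pi.single i k) := by
    intro i k m
    induction k with
    | zero => simp
    | succ k ih =>
      rw [Function.iterate_succ_apply', ih, hG, add_assoc, ← Pi.single_add]
  have fold : ∀ l : List (Fin N), l.foldr (fun i F => (partialDeriv i)^[p i] F) (G 0)
      = G (l.map fun i => Pi.single i (p i)).sum := by
    intro l
    induction l with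
    | nil => simp
    | cons i l ih => rw [List.foldr_cons, ih, iter, List.map_cons, List.sum_cons, add_comm]
  rw [multiDeriv, fold, ← Fin.sum_univ_def, Finset.univ_sum_single]

theorem partialDeriv_of_hasFDerivAt {F : EuclideanSpace ℝ (Fin N) → ℝ}
    {c : Fin N → EuclideanSpace ℝ (Fin N) → ℝ}
    (h : ∀ x, HasFDerivAt F
      (∑ i, c i x • (EuclideanSpace.proj i : EuclideanSpace ℝ (Fin N) →L[ℝ] ℝ)) x)
    (i : Fin N) : partialDeriv i F = c i := by
  funext x
  rw [partialDeriv, ((h x).hasLineDerivAt _).lineDeriv]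
  simp

/-- The product rule for products of functions of one coordinate each. -/
theorem hasFDerivAt_prod_coord (f : Fin N → ℕ → ℝ → ℝ)
    (hf : ∀ j n t, HasDerivAt (f j n) (f j (n + 1) t) t) (m : Fin N → ℕ)
    (x : EuclideanSpace ℝ (Fin N)) :
    HasFDerivAt (fun x : EuclideanSpace ℝ (Fin N) => ∏ j, f j (m j) (x j))
      (∑ i, (∏ j, f j ((m + Pi.single i 1 : Fin N → ℕ) j) (x j)) •
        (EuclideanSpace.proj i : EuclideanSpace ℝ (Fin N) →L[ℝ] ℝ)) x := by
  have h1 : ∀ j, HasFDerivAt (fun x : EuclideanSpace ℝ (Fin N) => f j (m j) (x j))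
      (f j (m j + 1) (x j) •
        (EuclideanSpace.proj j : EuclideanSpace ℝ (Fin N) →L[ℝ] ℝ)) x := fun j =>
    (hf j (m j) (x j)).comp_hasFDerivAt x
      (EuclideanSpace.proj j : EuclideanSpace ℝ (Fin N) →L[ℝ] ℝ).hasFDerivAt
  refine (HasFDerivAt.finsetProd (u := Finset.univ) fun j _ => h1 j).congr_fderiv ?_
  refine Finset.sum_congr rfl fun i _ => ?_
  rw [smul_smul]
  congr 1
  rw [← Finset.prod_erase_mul Finset.univ _ (Finset.mem_univ i)]
  congr 1
  · refine Finset.prod_congr rfl fun j hj => ?_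
    simp [Finset.ne_of_mem_erase hj]
  · simp

/-- `multiDeriv` of a product of functions of one coordinate each. -/
theorem multiDeriv_prod_coord (C : ℝ) (f : Fin N → ℕ → ℝ → ℝ)
    (hf : ∀ j n t, HasDerivAt (f j n) (f j (n + 1) t) t) (p : Fin N → ℕ) :
    multiDeriv p (fun x => C * ∏ j, f j 0 (x j)) = fun x => C * ∏ j, f j (p j) (x j) := by
  refine multiDeriv_of_family (fun m x => C * ∏ j, f j (m j) (x j)) (fun m i => ?_) p
  refine partialDeriv_of_hasFDerivAt (c := fun i x => C * ∏ j, f j ((m + Pi.single i 1 : Fin N → ℕ) j) (x j))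
    (fun x => ?_) i
  refine ((hasFDerivAt_prod_coord f hf m x).const_mul C).congr_fderiv ?_
  simp [Finset.smul_sum, smul_smul]

/-- The derivative `∂^m` of the monomial `x^q`. -/
noncomputable def monoDeriv (q m : Fin N → ℕ) (x : EuclideanSpace ℝ (Fin N)) : ℝ :=
  ∏ j, ((q j).descFactorial (m j) : ℝ) * x j ^ (q j - m j)

theorem monoDeriv_zero (q : Fin N → ℕ) (x : EuclideanSpace ℝ (Fin N)) :
    monoDeriv q 0 x = mpow x q := by
  simp [monoDeriv, mpow]

theorem hasFDerivAt_monoDeriv (q m : Fin N → ℕ) (x : EuclideanSpace ℝ (Fin N)) :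
    HasFDerivAt (monoDeriv q m) (∑ i, monoDeriv q (m + Pi.single i 1) x •
        (EuclideanSpace.proj i : EuclideanSpace ℝ (Fin N) →L[ℝ] ℝ)) x := by
  refine hasFDerivAt_prod_coord
    (fun j n t => ((q j).descFactorial n : ℝ) * t ^ (q j - n)) (fun j n t => ?_) m x
  refine ((hasDerivAt_pow (q j - n) t).const_mul _).congr_deriv ?_
  rw [Nat.descFactorial_succ, Nat.sub_sub]
  push_cast
  ring

theorem monoDeriv_self_zero (p : Fin N → ℕ) : monoDeriv p p 0 = mfactorial p := by
  simp [monoDeriv, mfactorial, Nat.descFactorial_self]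

theorem monoDeriv_apply_zero_of_ne {q p : Fin N → ℕ} (h : q ≠ p) : monoDeriv q p 0 = 0 := by
  obtain ⟨j, hj⟩ := Function.ne_iff.1 h
  refine Finset.prod_eq_zero (Finset.mem_univ j) ?_
  rcases lt_or_gt_of_ne hj with h | h
  · simp [Nat.descFactorial_of_lt h]
  · have : q j - p j ≠ 0 := by omega
    simp [this]

/-- A falling factorial is `m!` times a binomial coefficient, which is at most `2^q`. The bound
stays geometric in the degree, so differentiation does not spoil convergence for series of infinite
radius. -/
theorem abs_monoDeriv_le (q m : Fin N → ℕ) {R : ℝ} (hR : 1 ≤ R) {x : EuclideanSpace ℝ (Fin N)}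
    (hx : ‖x‖ ≤ R) : |monoDeriv q m x| ≤ mfactorial m * (2 * R) ^ ∑ j, q j := by
  rw [monoDeriv, mfactorial, Finset.abs_prod, ← Finset.prod_pow_eq_pow_sum,
    ← Finset.prod_mul_distrib]
  refine Finset.prod_le_prod (fun _ _ => abs_nonneg _) fun j _ => ?_
  rw [abs_mul, abs_pow, Nat.abs_cast, mul_pow, ← mul_assoc]
  have h1 : ((q j).descFactorial (m j) : ℝ) ≤ (m j).factorial * 2 ^ q j := by
    rw [Nat.descFactorial_eq_factorial_mul_choose]
    exact_mod_cast Nat.mul_le_mul_left _ (Nat.choose_le_two_pow _ _)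
  have h2 : |x j| ^ (q j - m j) ≤ R ^ q j :=
    (pow_le_pow_left₀ (abs_nonneg _) ((PiLp.norm_apply_le x j).trans hx) _).trans
      (pow_le_pow_right₀ hR (Nat.sub_le _ _))
  exact mul_le_mul h1 h2 (by positivity) (by positivity)

end Calculus

/-! ### Termwise differentiation of everywhere convergent power series -/

section PowerSeries

variable {N : ℕ} {ι : Type*}

/-- The termwise derivative `∂^m` of the power series `∑ₖ bₖ x^{qₖ}`. -/
noncomputable def seriesDeriv (b : ι → ℝ) (q : ι → Fin N → ℕ) (m : Fin N → ℕ)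
    (x : EuclideanSpace ℝ (Fin N)) : ℝ :=
  ∑' k, b k * monoDeriv (q k) m x

variable {b : ι → ℝ} {q : ι → Fin N → ℕ}

theorem summable_seriesDeriv (hb : ∀ R : ℝ, Summable fun k => |b k| * R ^ ∑ j, q k j)
    (m : Fin N → ℕ) (x : EuclideanSpace ℝ (Fin N)) :
    Summable fun k => b k * monoDeriv (q k) m x := by
  refine Summable.of_norm_bounded
    ((hb (2 * max 1 ‖x‖)).mul_left (mfactorial m)) fun k => ?_
  rw [Real.norm_eq_abs, abs_mul, mul_left_comm]
  exact mul_le_mul_of_nonneg_left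
    (abs_monoDeriv_le _ _ (le_max_left _ _) (le_max_right _ _)) (abs_nonneg _)

theorem norm_proj_le (i : Fin N) :
    ‖(EuclideanSpace.proj i : EuclideanSpace ℝ (Fin N) →L[ℝ] ℝ)‖ ≤ 1 :=
  ContinuousLinearMap.opNorm_le_bound _ zero_le_one fun x => by
    simpa using PiLp.norm_apply_le x i

theorem hasFDerivAt_seriesDeriv (hb : ∀ R : ℝ, Summable fun k => |b k| * R ^ ∑ j, q k j)
    (m : Fin N → ℕ) (x : EuclideanSpace ℝ (Fin N)) :
    HasFDerivAt (seriesDeriv b q m) (∑ i, seriesDeriv b q (m + Pi.single i 1) x •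
        (EuclideanSpace.proj i : EuclideanSpace ℝ (Fin N) →L[ℝ] ℝ)) x := by
  -- Any radius larger than `‖x‖` and at least `1` serves; the second condition is needed for
  -- `abs_monoDeriv_le`, which also accounts for the `2 * R` in the majorant.
  set R : ℝ := ‖x‖ + 1 with hR
  have hR1 : 1 ≤ R := by simp [hR]
  let D : ι → EuclideanSpace ℝ (Fin N) → EuclideanSpace ℝ (Fin N) →L[ℝ] ℝ := fun k z =>
    b k • ∑ i, monoDeriv (q k) (m + Pi.single i 1) z •
      (EuclideanSpace.proj i : EuclideanSpace ℝ (Fin N) →L[ℝ] ℝ)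
  have key : HasFDerivAt (fun z => ∑' k, b k * monoDeriv (q k) m z) (∑' k, D k x) x := by
    have hmem : x ∈ Metric.ball (0 : EuclideanSpace ℝ (Fin N)) R := by simp [hR]
    have hu := (hb (2 * R)).mul_left (∑ i : Fin N, mfactorial (m + Pi.single i 1))
    have hconn : IsPreconnected (Metric.ball (0 : EuclideanSpace ℝ (Fin N)) R) :=
      (convex_ball 0 R).isPreconnected
    refine hasFDerivAt_tsum_of_isPreconnected (f := fun k z => b k * monoDeriv (q k) m z)
      (f' := D) (s := Metric.ball 0 R) (x₀ := x) (x := x)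
      hu Metric.isOpen_ball hconn
      (fun k z _ => (hasFDerivAt_monoDeriv (q k) m z).const_mul (b k))
      (fun k z hz => ?_) hmem (summable_seriesDeriv hb m x) hmem
    have hz' : ‖z‖ ≤ R := by simpa using (Metric.mem_ball.1 hz).le
    simp only [D]
    rw [norm_smul, Real.norm_eq_abs, mul_left_comm, Finset.sum_mul]
    refine mul_le_mul_of_nonneg_left ((norm_sum_le _ _).trans
      (Finset.sum_le_sum fun i _ => ?_)) (abs_nonneg _)
    rw [norm_smul, Real.norm_eq_abs]
    exact (mul_le_of_le_one_right (abs_nonneg _) (norm_proj_le i)).trans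
      (abs_monoDeriv_le _ _ hR1 hz')
  refine key.congr_fderiv (HasSum.tsum_eq ?_)
  have : ∀ k, D k x = ∑ i, (b k * monoDeriv (q k) (m + Pi.single i 1) x) •
      (EuclideanSpace.proj i : EuclideanSpace ℝ (Fin N) →L[ℝ] ℝ) := fun k => by
    simp [D, Finset.smul_sum, smul_smul]
  simp_rw [this]
  exact hasSum_sum fun i _ => (summable_seriesDeriv hb _ x).hasSum.smul_const _

/-- The derivative is assembled from series of the same kind with shifted index, so the induction on
the order treats all `m` at once. -/
theorem contDiff_seriesDeriv (hb : ∀ R : ℝ, Summable fun k => |b k| * R ^ ∑ j, q k j)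
    (m : Fin N → ℕ) : ContDiff ℝ ∞ (seriesDeriv b q m) := by
  rw [contDiff_infty]
  intro n
  induction n generalizing m with
  | zero =>
    exact contDiff_zero.2 (continuous_iff_continuousAt.2 fun x =>
      (hasFDerivAt_seriesDeriv hb m x).continuousAt)
  | succ n ih =>
    rw [Nat.cast_add, Nat.cast_one, contDiff_succ_iff_fderiv]
    refine ⟨fun x => (hasFDerivAt_seriesDeriv hb m x).differentiableAt, by simp, ?_⟩
    rw [funext fun x => (hasFDerivAt_seriesDeriv hb m x).fderiv]
    exact ContDiff.sum fun i _ => (ih _).smul contDiff_const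

theorem multiDeriv_series (hb : ∀ R : ℝ, Summable fun k => |b k| * R ^ ∑ j, q k j)
    (p : Fin N → ℕ) : multiDeriv p (seriesDeriv b q 0) = seriesDeriv b q p :=
  multiDeriv_of_family _ (fun m i => partialDeriv_of_hasFDerivAt
    (c := fun i x => seriesDeriv b q (m + Pi.single i 1) x)
    (fun x => hasFDerivAt_seriesDeriv hb m x) i) p

end PowerSeries

/-! ### Sums over multi-indices -/

section MultiIndexSums

variable {N : ℕ}

theorem mfactorial_pos (p : Fin N → ℕ) : 0 < mfactorial p :=
  Finset.prod_pos fun _ _ => by positivity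

/-- A product of nonnegative convergent series is the sum over all multi-indices. -/
theorem hasSum_prod_of_nonneg {f : Fin N → ℕ → ℝ} {s : Fin N → ℝ} (hf0 : ∀ i n, 0 ≤ f i n)
    (hf : ∀ i, HasSum (f i) (s i)) :
    HasSum (fun p : Fin N → ℕ => ∏ i, f i (p i)) (∏ i, s i) := by
  -- Sums over cubes factor, and cubes are cofinal among finite sets of multi-indices; nonnegativity
  -- then gives summability and identifies the sum.
  have box : ∀ n : ℕ, ∑ p ∈ Fintype.piFinset fun _ : Fin N => Finset.range n, ∏ i, f i (p i)
      = ∏ i, ∑ k ∈ Finset.range n, f i k := fun n => (Finset.prod_univ_sum _ _).symm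
  have hmono : Tendsto (fun n : ℕ => Fintype.piFinset fun _ : Fin N => Finset.range n)
      atTop atTop := by
    refine tendsto_atTop_finset_of_monotone
      (fun a b h => Fintype.piFinset_subset _ _ fun _ => Finset.range_mono h) fun p => ?_
    refine ⟨(Finset.univ.sup p) + 1, ?_⟩
    rw [Fintype.mem_piFinset]
    intro i
    exact Finset.mem_range.2 (Nat.lt_succ_of_le (Finset.le_sup (Finset.mem_univ i)))
  have hlim : Tendsto (fun n : ℕ => ∏ i, ∑ k ∈ Finset.range n, f i k) atTop (𝓝 (∏ i, s i)) :=
    tendsto_finsetProd _ fun i _ => (hf i).tendsto_sum_nat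
  have hsum : Summable fun p : Fin N → ℕ => ∏ i, f i (p i) := by
    refine summable_of_sum_le (c := ∏ i, s i)
      (fun p => Finset.prod_nonneg fun i _ => hf0 i _) fun u => ?_
    obtain ⟨n, hn⟩ := (hmono.eventually (eventually_ge_atTop u)).exists
    refine (Finset.sum_le_sum_of_subset_of_nonneg hn
      fun p _ _ => Finset.prod_nonneg fun i _ => hf0 i _).trans ?_
    rw [box]
    exact Finset.prod_le_prod (fun i _ => Finset.sum_nonneg fun k _ => hf0 i k)
      fun i _ => sum_le_hasSum _ (fun k _ => hf0 i k) (hf i)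
  have := hsum.hasSum.comp hmono
  simp only [Function.comp_def, box] at this
  rw [tendsto_nhds_unique hlim this]
  exact hsum.hasSum

theorem hasSum_mpow_sq_div_mfactorial (x : EuclideanSpace ℝ (Fin N)) :
    HasSum (fun p : Fin N → ℕ => mpow x p ^ 2 / mfactorial p) (Real.exp (‖x‖ ^ 2)) := by
  have h := hasSum_prod_of_nonneg (f := fun i n => (x i ^ 2) ^ n / (n.factorial : ℝ))
    (s := fun i => Real.exp (x i ^ 2)) (fun i n => by positivity) fun i => by
      rw [Real.exp_eq_exp_ℝ]; exact NormedSpace.expSeries_div_hasSum_exp _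
  rw [← Real.exp_sum, ← EuclideanSpace.real_norm_sq_eq] at h
  convert h using 2 with p
  rw [mpow, mfactorial, ← Finset.prod_pow, ← Finset.prod_div_distrib]
  exact Finset.prod_congr rfl fun i _ => by rw [← pow_mul, ← pow_mul, mul_comm]

/-- Square-summable coefficients give an everywhere convergent series: `uv ≤ u² + v²` bounds the
terms by `a_p²` plus `R^{2|p|}/p!`, and the latter sum to an exponential. -/
theorem summable_coeff_mul_pow {S : ℕ} {a : SparseIndex N S → ℝ} (ha : Summable fun p => a p ^ 2)
    (R : ℝ) : Summable fun p : SparseIndex N S =>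
      |a p / √(mfactorial p.1)| * R ^ ∑ j, p.1 j := by
  have h := (hasSum_mpow_sq_div_mfactorial
    (WithLp.toLp 2 fun _ : Fin N => R)).summable.comp_injective
      (Subtype.val_injective (p := fun p : Fin N → ℕ => (msupp p).card ≤ S))
  refine Summable.of_norm_bounded (ha.add h) fun p => ?_
  have hm : mpow (WithLp.toLp 2 fun _ : Fin N => R) p.1 = R ^ ∑ j, p.1 j := by
    simp [mpow, Finset.prod_pow_eq_pow_sum]
  simp only [Function.comp_def, hm]
  have hs : 0 < √(mfactorial p.1) := Real.sqrt_pos.2 (mfactorial_pos _)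
  rw [norm_mul, norm_pow, Real.norm_eq_abs, Real.norm_eq_abs, abs_abs, abs_div, abs_of_pos hs]
  set r := R ^ ∑ j, p.1 j
  have hr : |R| ^ ∑ j, p.1 j = |r| := (abs_pow _ _).symm
  rw [hr]
  have : r ^ 2 / mfactorial p.1 = (|r| / √(mfactorial p.1)) ^ 2 := by
    rw [div_pow, Real.sq_sqrt (mfactorial_pos _).le, sq_abs]
  rw [this, ← sq_abs (a p), div_mul_eq_mul_div, mul_div_assoc]
  nlinarith [sq_nonneg (|a p| - |r| / √(mfactorial p.1)), sq_nonneg (|a p|),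
    sq_nonneg (|r| / √(mfactorial p.1))]

end MultiIndexSums

/-! ### Uniqueness of the coefficient sequence -/

section Coefficients

variable {N S : ℕ}

theorem mpow_zeroOff (I : Finset (Fin N)) (x : EuclideanSpace ℝ (Fin N)) (q : Fin N → ℕ) :
    mpow (zeroOff I x) q = if msupp q ⊆ I then mpow x q else 0 := by
  split_ifs with h
  · refine Finset.prod_congr rfl fun i _ => ?_
    by_cases hi : i ∈ I
    · simp [zeroOff, hi]
    · have : q i = 0 := by
        by_contra h0
        exact hi (h (by simp [msupp, h0]))
      simp [this]
  · obtain ⟨i, hi, hiI⟩ := Finset.not_subset.1 h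
    refine Finset.prod_eq_zero (Finset.mem_univ i) ?_
    have : q i ≠ 0 := by simpa [msupp] using hi
    simp [zeroOff, hiI, this]

theorem nu_pos (σ : ℝ) (x₀ x : EuclideanSpace ℝ (Fin N)) : 0 < nu σ x₀ x := Real.exp_pos _

/-- Restriction to the coordinate subspace of `supp p` kills exactly the monomials whose support is
not contained in `supp p`, and the factor `ν` cancels. -/
theorem scaledMean_eq_series {σ : ℝ} (hσ : 0 < σ) {x₀ : sparseSet N S} {γ : sparseSet N S → ℝ}
    {a : SparseIndex N S → ℝ} (ha : IsCoeffSeq σ x₀ γ a) (p : SparseIndex N S) :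
    scaledMean σ x₀ γ p = seriesDeriv
      (fun q : SparseIndex N S =>
        if msupp q.1 ⊆ msupp p.1 then a q / √(mfactorial q.1) else 0)
      Subtype.val 0 := by
  funext x
  have h := (ha.2 ⟨σ • zeroOff (msupp p.1) x, smul_zeroOff_mem_sparseSet p.2 σ x⟩).2
  rw [scaledMean, h, one_div, mul_comm, mul_inv_cancel_left₀ (nu_pos _ _ _).ne', seriesDeriv]
  refine tsum_congr fun q => ?_
  rw [monoDeriv_zero, inv_smul_smul₀ hσ.ne', mpow_zeroOff]
  split_ifs <;> simp

/-- At the origin only the monomial `x^p` survives `∂^p`, with value `p!`. Since `coeff` depends on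
`γ` alone, this also proves uniqueness of `a`. -/
theorem contDiff_scaledMean_and_coeff_eq {σ : ℝ} (hσ : 0 < σ) {x₀ : sparseSet N S}
    {γ : sparseSet N S → ℝ} {a : SparseIndex N S → ℝ} (ha : IsCoeffSeq σ x₀ γ a)
    (p : SparseIndex N S) :
    ContDiff ℝ ∞ (scaledMean σ x₀ γ p) ∧ coeff σ x₀ γ p = a p := by
  have hb : ∀ R : ℝ, Summable fun q : SparseIndex N S =>
      |if msupp q.1 ⊆ msupp p.1 then a q / √(mfactorial q.1) else 0| * R ^ ∑ j, q.1 j := by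
    intro R
    refine Summable.of_norm_bounded (summable_coeff_mul_pow ha.1 |R|) fun q => ?_
    rw [norm_mul, norm_pow, Real.norm_eq_abs, Real.norm_eq_abs, abs_abs]
    refine mul_le_mul_of_nonneg_right ?_ (by positivity)
    split_ifs <;> simp
  rw [coeff, scaledMean_eq_series hσ ha]
  refine ⟨contDiff_seriesDeriv hb 0, ?_⟩
  rw [multiDeriv_series hb, seriesDeriv, tsum_eq_single p fun q hq => by
    rw [monoDeriv_apply_zero_of_ne fun h => hq (Subtype.ext h), mul_zero], monoDeriv_self_zero]
  have hs := mfactorial_pos p.1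
  simp only [subset_refl, if_true]
  have : √(mfactorial p.1) ≠ 0 := (Real.sqrt_pos.2 hs).ne'
  field_simp
  rw [Real.sq_sqrt hs.le, mul_comm]

end Coefficients

end SSNM

namespace SSNM

/-! ### Hermite polynomials and one-dimensional Gaussian integrals -/

section Hermite

/-- The probabilists' Hermite polynomial as a real function. -/
noncomputable def hermiteFun (n : ℕ) (w : ℝ) : ℝ := Polynomial.aeval w (Polynomial.hermite n)

theorem hermiteFun_zero (w : ℝ) : hermiteFun 0 w = 1 := by simp [hermiteFun]

theorem derivative_hermite_succ (n : ℕ) : Polynomial.derivative (Polynomial.hermite (n + 1)) =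
    (n + 1 : Polynomial ℤ) * Polynomial.hermite n := by
  induction n with
  | zero => simp
  | succ n ih =>
    rw [Polynomial.hermite_succ (n + 1), Polynomial.derivative_sub, Polynomial.derivative_mul,
      ih, Polynomial.derivative_X, Polynomial.derivative_mul, Polynomial.hermite_succ n]
    simp only [Polynomial.derivative_add, Polynomial.derivative_natCast, Polynomial.derivative_one]
    push_cast
    ring

theorem hasDerivAt_hermiteFun (n : ℕ) (w : ℝ) :
    HasDerivAt (hermiteFun n) (w * hermiteFun n w - hermiteFun (n + 1) w) w := by
  refine ((Polynomial.hermite n).hasDerivAt_aeval w).congr_deriv ?_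
  simp [hermiteFun, Polynomial.hermite_succ]

theorem hasDerivAt_hermiteFun_succ (n : ℕ) (w : ℝ) :
    HasDerivAt (hermiteFun (n + 1)) ((n + 1) * hermiteFun n w) w := by
  refine ((Polynomial.hermite (n + 1)).hasDerivAt_aeval w).congr_deriv ?_
  rw [derivative_hermite_succ]
  simp [hermiteFun]

theorem continuous_hermiteFun (n : ℕ) : Continuous (hermiteFun n) :=
  continuous_iff_continuousAt.2 fun w => (hasDerivAt_hermiteFun n w).continuousAt

/-- The functions `t ↦ Heₙ(w - t) exp(w t - t²/2)` are the derivatives of the generating function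
of the Hermite polynomials. -/
theorem hasDerivAt_hermite_generating (w : ℝ) (n : ℕ) (t : ℝ) :
    HasDerivAt (fun t => hermiteFun n (w - t) * Real.exp (w * t - t ^ 2 / 2))
      (hermiteFun (n + 1) (w - t) * Real.exp (w * t - t ^ 2 / 2)) t := by
  have h1 : HasDerivAt (fun t => hermiteFun n (w - t))
      (((w - t) * hermiteFun n (w - t) - hermiteFun (n + 1) (w - t)) * (-1)) t :=
    (hasDerivAt_hermiteFun n (w - t)).comp t ((hasDerivAt_id t).const_sub w)
  have h2 : HasDerivAt (fun t => Real.exp (w * t - t ^ 2 / 2))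
      (Real.exp (w * t - t ^ 2 / 2) * (w * 1 - (2 * t) / 2)) t := by
    refine (((hasDerivAt_id t).const_mul w).sub (((hasDerivAt_pow 2 t).div_const 2))).exp.congr_deriv
      ?_
    simp
  refine (h1.mul h2).congr_deriv ?_
  ring

theorem integrable_eval_mul_gaussian (P : Polynomial ℝ) :
    Integrable fun w : ℝ => P.eval w * Real.exp (-(w ^ 2 / 2)) := by
  induction P using Polynomial.induction_on' with
  | add p q hp hq =>
    refine (hp.add hq).congr (Eventually.of_forall fun w => ?_)
    simp [add_mul]
  | monomial n a =>
    have h := (integrable_rpow_mul_exp_neg_mul_sq (b := 1 / 2) (by norm_num) (s := n)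
      (lt_of_lt_of_le (by norm_num) (Nat.cast_nonneg n))).const_mul a
    refine h.congr (Eventually.of_forall fun w => ?_)
    simp only [Polynomial.eval_monomial, Real.rpow_natCast]
    rw [mul_assoc]
    congr 3
    ring

/-- Completing the square turns the exponential factor into a translation by `x`, compensated by
translating the polynomial. -/
theorem integrable_eval_mul_exp_mul_gaussian (P : Polynomial ℝ) (x : ℝ) :
    Integrable fun w : ℝ => P.eval w * Real.exp (x * w) * Real.exp (-(w ^ 2 / 2)) := by
  have h := ((integrable_eval_mul_gaussian
    (P.comp (Polynomial.X + Polynomial.C x))).comp_sub_right x).const_mul (Real.exp (x ^ 2 / 2))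
  refine h.congr (Eventually.of_forall fun w => ?_)
  simp only [Polynomial.eval_comp, Polynomial.eval_add, Polynomial.eval_X, Polynomial.eval_C,
    sub_add_cancel]
  rw [mul_left_comm, ← Real.exp_add, mul_assoc, ← Real.exp_add]
  congr 2
  ring

theorem hermiteFun_eq_eval (n : ℕ) (w : ℝ) :
    hermiteFun n w = ((Polynomial.hermite n).map (Int.castRingHom ℝ)).eval w := by
  rw [hermiteFun, Polynomial.aeval_def, Polynomial.eval_map]
  rfl

theorem integrable_hermiteFun_mul_exp (n : ℕ) (x : ℝ) : Integrable fun w : ℝ =>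
    hermiteFun n w * Real.exp (x * w) * Real.exp (-(w ^ 2 / 2)) := by
  simpa only [hermiteFun_eq_eval] using integrable_eval_mul_exp_mul_gaussian _ x

theorem integrable_hermiteFun_mul_hermiteFun (n m : ℕ) : Integrable fun w : ℝ =>
    hermiteFun n w * hermiteFun m w * Real.exp (-(w ^ 2 / 2)) := by
  simpa only [hermiteFun_eq_eval, ← Polynomial.eval_mul] using integrable_eval_mul_gaussian _

theorem hasDerivAt_hermiteFun_mul_gaussian (n : ℕ) (w : ℝ) :
    HasDerivAt (fun w => hermiteFun n w * Real.exp (-(w ^ 2 / 2)))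
      (-(hermiteFun (n + 1) w * Real.exp (-(w ^ 2 / 2)))) w := by
  have h2 : HasDerivAt (fun w : ℝ => Real.exp (-(w ^ 2 / 2)))
      (Real.exp (-(w ^ 2 / 2)) * (-(2 * w / 2))) w := by
    simpa using ((hasDerivAt_pow 2 w).div_const 2).neg.exp
  refine ((hasDerivAt_hermiteFun n w).mul h2).congr_deriv ?_
  ring

/-- Gaussian integration by parts against Hermite polynomials. -/
theorem integral_hermiteFun_succ_mul (n : ℕ) {f f' : ℝ → ℝ} (hf : ∀ w, HasDerivAt f (f' w) w)
    (h1 : Integrable fun w => hermiteFun (n + 1) w * f w * Real.exp (-(w ^ 2 / 2)))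
    (h2 : Integrable fun w => hermiteFun n w * f' w * Real.exp (-(w ^ 2 / 2)))
    (h3 : Integrable fun w => hermiteFun n w * f w * Real.exp (-(w ^ 2 / 2))) :
    ∫ w, hermiteFun (n + 1) w * f w * Real.exp (-(w ^ 2 / 2)) =
      ∫ w, hermiteFun n w * f' w * Real.exp (-(w ^ 2 / 2)) := by
  have h := integral_mul_deriv_eq_deriv_mul_of_integrable (u := f) (u' := f')
    (v := fun w => hermiteFun n w * Real.exp (-(w ^ 2 / 2)))
    (v' := fun w => -(hermiteFun (n + 1) w * Real.exp (-(w ^ 2 / 2))))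
    (fun w _ => hf w) (fun w _ => hasDerivAt_hermiteFun_mul_gaussian n w)
    (h1.neg.congr (Eventually.of_forall fun w => by simp only [Pi.neg_apply, Pi.mul_apply]; ring))
    (h2.congr (Eventually.of_forall fun w => by simp only [Pi.mul_apply]; ring))
    (h3.congr (Eventually.of_forall fun w => by simp only [Pi.mul_apply]; ring))
  simp only [mul_neg, integral_neg, neg_inj] at h
  calc _ = ∫ w, f w * (hermiteFun (n + 1) w * Real.exp (-(w ^ 2 / 2))) :=
        integral_congr_ae (Eventually.of_forall fun w => by simp only; ring)
    _ = _ := h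
    _ = _ := integral_congr_ae (Eventually.of_forall fun w => by simp only; ring)

theorem integral_gaussian_half : ∫ w : ℝ, Real.exp (-(w ^ 2 / 2)) = √(2 * Real.pi) := by
  have h := integral_gaussian (1 / 2)
  rw [show Real.pi / (1 / 2) = 2 * Real.pi by ring] at h
  rw [← h]
  congr 1 with w
  congr 1
  ring

/-- Each integration by parts lowers the Hermite index and brings out a factor `x`; the base case is
the completed square. -/
theorem integral_hermiteFun_mul_exp (n : ℕ) (x : ℝ) :
    ∫ w, hermiteFun n w * Real.exp (x * w) * Real.exp (-(w ^ 2 / 2)) =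
      x ^ n * (√(2 * Real.pi) * Real.exp (x ^ 2 / 2)) := by
  induction n with
  | zero =>
    have h := integral_sub_right_eq_self (fun w : ℝ => Real.exp (-(w ^ 2 / 2))) x (μ := volume)
    rw [integral_gaussian_half] at h
    rw [pow_zero, one_mul, ← h, ← integral_mul_const]
    congr 1 with w
    rw [hermiteFun_zero, one_mul, ← Real.exp_add, ← Real.exp_add]
    congr 1
    ring
  | succ n ih =>
    have hd : ∀ w : ℝ, HasDerivAt (fun w => Real.exp (x * w)) (x * Real.exp (x * w)) w :=
      fun w => by simpa [mul_comm] using ((hasDerivAt_id w).const_mul x).exp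
    have hi : ∀ w : ℝ, hermiteFun n w * (x * Real.exp (x * w)) * Real.exp (-(w ^ 2 / 2)) =
        x * (hermiteFun n w * Real.exp (x * w) * Real.exp (-(w ^ 2 / 2))) := fun w => by ring
    rw [integral_hermiteFun_succ_mul n hd (integrable_hermiteFun_mul_exp _ _)
      (by simpa only [hi] using (integrable_hermiteFun_mul_exp n x).const_mul x)
      (integrable_hermiteFun_mul_exp _ _)]
    simp only [hi]
    rw [integral_const_mul, ih]
    ring

/-- Integration by parts together with `He'_{m+1} = (m+1) He_m` lowers both indices at once, until
one of them is zero. -/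
theorem integral_hermiteFun_mul_hermiteFun (n m : ℕ) :
    ∫ w, hermiteFun n w * hermiteFun m w * Real.exp (-(w ^ 2 / 2)) =
      if n = m then n.factorial * √(2 * Real.pi) else 0 := by
  -- The case `x = 0` of the exponential integral, where `0 ^ (k + 1) = 0`.
  have hzero : ∀ k, ∫ w, hermiteFun (k + 1) w * hermiteFun 0 w * Real.exp (-(w ^ 2 / 2)) = 0 := by
    intro k
    simpa [hermiteFun_zero] using integral_hermiteFun_mul_exp (k + 1) 0
  induction n generalizing m with
  | zero =>
    cases m with
    | zero => simp [hermiteFun_zero, integral_gaussian_half]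
    | succ m => simpa [mul_comm (hermiteFun 0 _)] using hzero m
  | succ n ih =>
    cases m with
    | zero => simpa using hzero n
    | succ m =>
      have hi : ∀ w : ℝ, hermiteFun n w * ((m + 1) * hermiteFun m w) * Real.exp (-(w ^ 2 / 2)) =
        (m + 1) * (hermiteFun n w * hermiteFun m w * Real.exp (-(w ^ 2 / 2))) := fun w => by ring
      rw [integral_hermiteFun_succ_mul n (hasDerivAt_hermiteFun_succ m)
        (integrable_hermiteFun_mul_hermiteFun _ _)
        (by simpa only [hi] using (integrable_hermiteFun_mul_hermiteFun n m).const_mul _)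
        (integrable_hermiteFun_mul_hermiteFun _ _)]
      simp only [hi, integral_const_mul, ih]
      by_cases h : n = m
      · subst h
        simp [Nat.factorial_succ, mul_assoc]
      · simp [h]

end Hermite

/-! ### Product integrals in affine coordinates -/

section ProductIntegrals

variable {N : ℕ}

theorem integrable_prod_affine {σ : ℝ} (hσ : 0 < σ) (a : Fin N → ℝ) {F : Fin N → ℝ → ℝ}
    (hF : ∀ i, Integrable (F i)) :
    Integrable fun y : EuclideanSpace ℝ (Fin N) => ∏ i, F i ((y i + a i) / σ) := by
  have h : Integrable fun y : Fin N → ℝ => ∏ i, F i ((y i + a i) / σ) :=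
    Integrable.fintype_prod (f := fun i t => F i ((t + a i) / σ)) fun i =>
      ((hF i).comp_div hσ.ne').comp_add_right (a i)
  exact ((PiLp.volume_preserving_ofLp (Fin N)).integrable_comp h.aestronglyMeasurable).2 h

theorem integral_prod_affine {σ : ℝ} (hσ : 0 < σ) (a : Fin N → ℝ) (F : Fin N → ℝ → ℝ) :
    ∫ y : EuclideanSpace ℝ (Fin N), ∏ i, F i ((y i + a i) / σ) = ∏ i, σ * ∫ w, F i w := by
  have h1 := (EuclideanSpace.volume_preserving_symm_measurableEquiv_toLp (Fin N)).integral_comp'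
    (fun y : Fin N → ℝ => ∏ i, F i ((y i + a i) / σ))
  refine h1.trans ?_
  rw [integral_fintype_prod_volume_eq_prod (fun i t => F i ((t + a i) / σ))]
  refine Finset.prod_congr rfl fun i _ => ?_
  rw [integral_add_right_eq_self (fun t => F i (t / σ)) (a i), Measure.integral_comp_div,
    abs_of_pos hσ, smul_eq_mul]

end ProductIntegrals

/-! ### Gaussian densities, the likelihood ratio and its factorization -/

section Densities

variable {N : ℕ}

theorem obsPdf_pos (σ : ℝ) (hσ : 0 < σ) (x y : EuclideanSpace ℝ (Fin N)) : 0 < obsPdf σ x y := by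
  unfold obsPdf
  have := Real.pi_pos
  positivity

theorem measurable_obsPdf (σ : ℝ) (x : EuclideanSpace ℝ (Fin N)) : Measurable (obsPdf σ x) := by
  refine Continuous.measurable ?_
  unfold obsPdf
  fun_prop

theorem obsPdf_eq_prod {σ : ℝ} (hσ : 0 < σ) (x y : EuclideanSpace ℝ (Fin N)) :
    obsPdf σ x y =
    ∏ i, ((√(2 * Real.pi) * σ)⁻¹ * Real.exp (-(((y i + -x i) / σ) ^ 2 / 2))) := by
  have h1 : (2 * Real.pi * σ ^ 2) ^ ((N : ℝ) / 2) = (√(2 * Real.pi) * σ) ^ N := by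
    rw [Real.rpow_div_two_eq_sqrt _ (by positivity), Real.rpow_natCast,
      Real.sqrt_mul (by positivity), Real.sqrt_sq hσ.le]
  rw [obsPdf, h1, Finset.prod_mul_distrib, ← Real.exp_sum, Finset.prod_const, Finset.card_univ,
    Fintype.card_fin, one_div, inv_pow, EuclideanSpace.real_norm_sq_eq, Finset.mul_sum]
  congr 2
  refine Finset.sum_congr rfl fun i _ => ?_
  simp only [PiLp.sub_apply]
  field_simp
  ring

/-- The likelihood ratio of the model with respect to `x₀`. -/
theorem obsPdf_eq_mul_psi_div_nu {σ : ℝ} (hσ : 0 < σ) (x₀ x y : EuclideanSpace ℝ (Fin N)) :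
   
    obsPdf σ x y = obsPdf σ x₀ y * (psi σ x₀ (σ⁻¹ • x) y / nu σ x₀ x) := by
  rw [obsPdf, obsPdf, psi, nu, ← Real.exp_sub, mul_assoc (1 / _), ← Real.exp_add,
    smul_inv_smul₀ hσ.ne', norm_smul, Real.norm_eq_abs, mul_pow, sq_abs, norm_sub_sq_real,
    norm_sub_sq_real, inner_sub_right, real_inner_smul_right, real_inner_comm x₀ x]
  congr 2
  field_simp
  ring

theorem psi_eq_prod (σ : ℝ) (x₀ x y : EuclideanSpace ℝ (Fin N)) :
    psi σ x₀ x y = psi σ x₀ 0 y *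
    ∏ i, Real.exp ((y i + x₀ i) / σ * x i - x i ^ 2 / 2) := by
  have h : ∀ u v : EuclideanSpace ℝ (Fin N), inner ℝ u v = ∑ i, u i * v i := fun u v => by
    simp [PiLp.inner_apply, mul_comm]
  rw [psi, psi, ← Real.exp_sum, ← Real.exp_add, inner_sub_right, inner_sub_right,
    real_inner_smul_right, Finset.sum_sub_distrib, ← Finset.sum_div,
    ← EuclideanSpace.real_norm_sq_eq]
  have h2 : ∑ i, (y i + x₀ i) / σ * x i = (inner ℝ y x + inner ℝ x₀ x) / σ := by
    rw [h, h, ← Finset.sum_add_distrib, Finset.sum_div]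
    exact Finset.sum_congr rfl fun i _ => by ring
  rw [h2]
  simp only [smul_zero, inner_zero_right, norm_zero]
  congr 1
  -- For `σ = 0` every quotient by `σ` is zero by convention, and the identity still holds.
  rcases eq_or_ne σ 0 with rfl | hσ
  · simp
  · field_simp
    ring

/-- The reweighting behind the orthonormal system: under the law at `-x₀`, `(y + x₀)/σ` is standard
normal. -/
theorem obsPdf_mul_psi_zero_sq {σ : ℝ} (hσ : 0 < σ) (x₀ y : EuclideanSpace ℝ (Fin N)) :
    obsPdf σ x₀ y * psi σ x₀ 0 y ^ 2 = obsPdf σ (-x₀) y := by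
  rw [obsPdf, obsPdf, psi, mul_assoc (1 / _), ← Real.exp_nat_mul, ← Real.exp_add, norm_sub_sq_real,
    norm_sub_sq_real, inner_neg_right, norm_neg]
  simp only [smul_zero, zero_sub, inner_neg_right, inner_zero_right, norm_zero]
  congr 2
  push_cast
  field_simp
  ring

end Densities

/-! ### Integrals under the model reduced to one-dimensional Gaussian integrals -/

section ModelIntegrals

variable {N S : ℕ} {σ : ℝ}

theorem integrable_model_iff (hσ : 0 < σ) (x : sparseSet N S) {G : EuclideanSpace ℝ (Fin N) → ℝ} :
    Integrable G (model N S σ x) ↔ Integrable fun y => obsPdf σ x.1 y * G y := by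
  rw [model, integrable_withDensity_iff_integrable_smul'
    (measurable_obsPdf σ x.1).ennreal_ofReal (by simp)]
  simp only [ENNReal.toReal_ofReal (obsPdf_pos σ hσ _ _).le, smul_eq_mul]

theorem integral_model (hσ : 0 < σ) (x : sparseSet N S) (G : EuclideanSpace ℝ (Fin N) → ℝ) :
    ∫ y, G y ∂(model N S σ x) = ∫ y, obsPdf σ x.1 y * G y := by
  rw [model, integral_withDensity_eq_integral_toReal_smul
    (measurable_obsPdf σ x.1).ennreal_ofReal (by simp)]
  simp only [ENNReal.toReal_ofReal (obsPdf_pos σ hσ _ _).le, smul_eq_mul]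

theorem isProbabilityMeasure_model (hσ : 0 < σ) (x : sparseSet N S) :
    IsProbabilityMeasure (model N S σ x) := by
  have hg : Integrable fun w : ℝ => Real.exp (-(w ^ 2 / 2)) := by
    simpa using integrable_eval_mul_gaussian 1
  have hi : Integrable (obsPdf σ x.1) := by
    rw [funext (obsPdf_eq_prod hσ x.1)]
    exact integrable_prod_affine hσ (fun i => -x.1 i)
      (F := fun _ w => (√(2 * Real.pi) * σ)⁻¹ * Real.exp (-(w ^ 2 / 2)))
      fun _ => hg.const_mul _
  have h1 : ∫ y, obsPdf σ x.1 y = 1 := by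
    rw [funext (obsPdf_eq_prod hσ x.1)]
    rw [integral_prod_affine hσ (fun i => -x.1 i)
      (fun _ w => (√(2 * Real.pi) * σ)⁻¹ * Real.exp (-(w ^ 2 / 2)))]
    refine Finset.prod_eq_one fun i _ => ?_
    have : √(2 * Real.pi) ≠ 0 := by positivity
    rw [integral_const_mul, integral_gaussian_half]
    field_simp
  constructor
  rw [model, withDensity_apply _ MeasurableSet.univ, Measure.restrict_univ,
    ← ofReal_integral_eq_lintegral_ofReal hi
      (Eventually.of_forall fun y => (obsPdf_pos σ hσ _ _).le), h1, ENNReal.ofReal_one]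

theorem obsPdf_mul_psi_sq_mul_prod (hσ : 0 < σ) (x₀ : EuclideanSpace ℝ (Fin N))
    (F : Fin N → ℝ → ℝ) (y : EuclideanSpace ℝ (Fin N)) :
    obsPdf σ x₀ y * (psi σ x₀ 0 y ^ 2 * ∏ i, F i ((y i + x₀ i) / σ)) =
      ∏ i, (fun w => (√(2 * Real.pi) * σ)⁻¹ * (F i w * Real.exp (-(w ^ 2 / 2))))
        ((y i + x₀ i) / σ) := by
  rw [← mul_assoc, obsPdf_mul_psi_zero_sq hσ, obsPdf_eq_prod hσ, ← Finset.prod_mul_distrib]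
  refine Finset.prod_congr rfl fun i _ => ?_
  simp only [PiLp.neg_apply, neg_neg]
  ring

theorem integrable_psi_sq_mul_prod (hσ : 0 < σ) (x₀ : sparseSet N S) {F : Fin N → ℝ → ℝ}
    (hF : ∀ i, Integrable fun w => F i w * Real.exp (-(w ^ 2 / 2))) :
    Integrable (fun y => psi σ x₀.1 0 y ^ 2 * ∏ i, F i ((y i + x₀.1 i) / σ))
      (model N S σ x₀) := by
  rw [integrable_model_iff hσ, funext (obsPdf_mul_psi_sq_mul_prod hσ x₀.1 F)]
  exact integrable_prod_affine hσ (fun i => x₀.1 i) fun i => (hF i).const_mul _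

theorem integral_psi_sq_mul_prod (hσ : 0 < σ) (x₀ : sparseSet N S) (F : Fin N → ℝ → ℝ) :
    ∫ y, psi σ x₀.1 0 y ^ 2 * ∏ i, F i ((y i + x₀.1 i) / σ) ∂(model N S σ x₀) =
      ∏ i, (√(2 * Real.pi))⁻¹ * ∫ w, F i w * Real.exp (-(w ^ 2 / 2)) := by
  rw [integral_model hσ, funext (obsPdf_mul_psi_sq_mul_prod hσ x₀.1 F)]
  rw [integral_prod_affine hσ (fun i => x₀.1 i)
    (fun i w => (√(2 * Real.pi) * σ)⁻¹ * (F i w * Real.exp (-(w ^ 2 / 2))))]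
  refine Finset.prod_congr rfl fun i _ => ?_
  rw [integral_const_mul]
  field_simp

end ModelIntegrals

/-! ### The orthonormal Hermite system and its pairing with the likelihood ratio -/

section HermiteSystem

variable {N S : ℕ} {σ : ℝ}

/-- The orthonormal system of (weighted) Hermite functions attached to `x₀`. -/
noncomputable def hermiteSystem (σ : ℝ) (x₀ : EuclideanSpace ℝ (Fin N)) (p : Fin N → ℕ)
    (y : EuclideanSpace ℝ (Fin N)) : ℝ :=
  psi σ x₀ 0 y * (∏ i, hermiteFun (p i) ((y i + x₀ i) / σ)) / √(mfactorial p)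

theorem continuous_psi (σ : ℝ) (x₀ x : EuclideanSpace ℝ (Fin N)) : Continuous (psi σ x₀ x) := by
  unfold psi
  fun_prop

theorem continuous_hermiteSystem (σ : ℝ) (x₀ : EuclideanSpace ℝ (Fin N)) (p : Fin N → ℕ) :
    Continuous (hermiteSystem σ x₀ p) := by
  have := continuous_psi σ x₀ 0
  have h := continuous_hermiteFun
  unfold hermiteSystem
  fun_prop

theorem multiDeriv_psi (σ : ℝ) (x₀ y : EuclideanSpace ℝ (Fin N)) (p : Fin N → ℕ) :
    multiDeriv p (fun x => psi σ x₀ x y) 0 =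
      psi σ x₀ 0 y * ∏ i, hermiteFun (p i) ((y i + x₀ i) / σ) := by
  have h := multiDeriv_prod_coord (psi σ x₀ 0 y)
    (fun (j : Fin N) n t => hermiteFun n ((y j + x₀ j) / σ - t) *
      Real.exp ((y j + x₀ j) / σ * t - t ^ 2 / 2))
    (fun j n t => hasDerivAt_hermite_generating _ n t) p
  simp only [hermiteFun_zero, one_mul, ← psi_eq_prod] at h
  rw [h]
  simp

theorem lmvTerm_eq (σ : ℝ) (x₀ : sparseSet N S) (γ : sparseSet N S → ℝ) (p : SparseIndex N S)
    (y : EuclideanSpace ℝ (Fin N)) :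
    lmvTerm σ x₀ γ p y = coeff σ x₀ γ p * hermiteSystem σ x₀.1 p.1 y := by
  rw [lmvTerm, multiDeriv_psi, hermiteSystem]
  ring

theorem hermiteSystem_mul (σ : ℝ) (x₀ : EuclideanSpace ℝ (Fin N)) (p q : Fin N → ℕ)
    (y : EuclideanSpace ℝ (Fin N)) :
    hermiteSystem σ x₀ p y * hermiteSystem σ x₀ q y =
      (√(mfactorial p) * √(mfactorial q))⁻¹ * (psi σ x₀ 0 y ^ 2 *
        ∏ i, (fun w => hermiteFun (p i) w * hermiteFun (q i) w) ((y i + x₀ i) / σ)) := by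
  rw [hermiteSystem, hermiteSystem, Finset.prod_mul_distrib]
  ring

theorem integral_hermiteSystem_mul (hσ : 0 < σ) (x₀ : sparseSet N S) (p q : Fin N → ℕ) :
    ∫ y, hermiteSystem σ x₀.1 p y * hermiteSystem σ x₀.1 q y ∂(model N S σ x₀) =
      if p = q then 1 else 0 := by
  have h2 : √(2 * Real.pi) ≠ 0 := by positivity
  rw [funext (hermiteSystem_mul σ x₀.1 p q), integral_const_mul,
    integral_psi_sq_mul_prod hσ x₀ (fun i w => hermiteFun (p i) w * hermiteFun (q i) w)]
  simp only [integral_hermiteFun_mul_hermiteFun]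
  split_ifs with h
  · subst h
    have hp := mfactorial_pos p
    have : ∏ i, ((√(2 * Real.pi))⁻¹ * if p i = p i then (p i).factorial * √(2 * Real.pi) else 0)
        = mfactorial p := by
      refine Finset.prod_congr rfl fun i _ => ?_
      rw [if_pos rfl]
      field_simp
    rw [this, Real.mul_self_sqrt hp.le, inv_mul_cancel₀ hp.ne']
  · obtain ⟨i, hi⟩ := Function.ne_iff.1 h
    rw [Finset.prod_eq_zero (Finset.mem_univ i) (by simp [hi]), mul_zero]

theorem memLp_hermiteSystem (hσ : 0 < σ) (x₀ : sparseSet N S) (p : Fin N → ℕ) :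
    MemLp (hermiteSystem σ x₀.1 p) 2 (model N S σ x₀) := by
  rw [memLp_two_iff_integrable_sq (continuous_hermiteSystem _ _ _).aestronglyMeasurable]
  simp only [sq (hermiteSystem _ _ _ _), hermiteSystem_mul]
  exact (integrable_psi_sq_mul_prod hσ x₀
    fun i => integrable_hermiteFun_mul_hermiteFun (p i) (p i)).const_mul _

theorem psi_mul_hermiteSystem (σ : ℝ) (x₀ x : EuclideanSpace ℝ (Fin N)) (p : Fin N → ℕ)
    (y : EuclideanSpace ℝ (Fin N)) :
    hermiteSystem σ x₀ p y * psi σ x₀ x y =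
      (√(mfactorial p))⁻¹ * Real.exp (-(‖x‖ ^ 2 / 2)) * (psi σ x₀ 0 y ^ 2 *
        ∏ i, (fun w => hermiteFun (p i) w * Real.exp (x i * w)) ((y i + x₀ i) / σ)) := by
  rw [hermiteSystem, psi_eq_prod σ x₀ x y, Finset.prod_mul_distrib, EuclideanSpace.real_norm_sq_eq,
    Finset.sum_div, ← Finset.sum_neg_distrib, Real.exp_sum]
  simp only [sub_eq_add_neg, Real.exp_add, Finset.prod_mul_distrib, mul_comm (x _)]
  ring

theorem integral_hermiteSystem_mul_psi (hσ : 0 < σ) (x₀ : sparseSet N S)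
    (x : EuclideanSpace ℝ (Fin N)) (p : Fin N → ℕ) :
    ∫ y, hermiteSystem σ x₀.1 p y * psi σ x₀.1 x y ∂(model N S σ x₀) =
      mpow x p / √(mfactorial p) := by
  have h2 : √(2 * Real.pi) ≠ 0 := by positivity
  rw [funext (psi_mul_hermiteSystem σ x₀.1 x p), integral_const_mul,
    integral_psi_sq_mul_prod hσ x₀ (fun i w => hermiteFun (p i) w * Real.exp (x i * w))]
  simp only [integral_hermiteFun_mul_exp]
  have : ∏ i, ((√(2 * Real.pi))⁻¹ * (x i ^ p i * (√(2 * Real.pi) * Real.exp (x i ^ 2 / 2))))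
      = mpow x p * Real.exp (‖x‖ ^ 2 / 2) := by
    rw [EuclideanSpace.real_norm_sq_eq, Finset.sum_div, Real.exp_sum, mpow,
      ← Finset.prod_mul_distrib]
    refine Finset.prod_congr rfl fun i _ => ?_
    field_simp
  rw [this, Real.exp_neg]
  field_simp

/-- The factor `hermiteFun 0`, which equals `1`, is inserted so that the integral of `He_n` against
an exponential applies with `n = 0` and argument `2 * x i`. -/
theorem psi_sq (σ : ℝ) (x₀ x y : EuclideanSpace ℝ (Fin N)) :
    psi σ x₀ x y ^ 2 = Real.exp (-‖x‖ ^ 2) * (psi σ x₀ 0 y ^ 2 *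
        ∏ i, (fun w => hermiteFun 0 w * Real.exp (2 * x i * w)) ((y i + x₀ i) / σ)) := by
  rw [psi_eq_prod, EuclideanSpace.real_norm_sq_eq, ← Finset.sum_neg_distrib, Real.exp_sum, mul_pow,
    ← Finset.prod_pow, mul_left_comm, ← Finset.prod_mul_distrib]
  congr 1
  refine Finset.prod_congr rfl fun i _ => ?_
  simp only [hermiteFun_zero, one_mul]
  rw [← Real.exp_nat_mul, ← Real.exp_add]
  congr 1
  push_cast
  ring

theorem integral_psi_sq (hσ : 0 < σ) (x₀ : sparseSet N S) (x : EuclideanSpace ℝ (Fin N)) :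
    ∫ y, psi σ x₀.1 x y ^ 2 ∂(model N S σ x₀) = Real.exp (‖x‖ ^ 2) := by
  have h2 : √(2 * Real.pi) ≠ 0 := by positivity
  rw [funext (psi_sq σ x₀.1 x), integral_const_mul,
    integral_psi_sq_mul_prod hσ x₀ (fun i w => hermiteFun 0 w * Real.exp (2 * x i * w))]
  simp only [integral_hermiteFun_mul_exp, EuclideanSpace.real_norm_sq_eq, ← Finset.sum_neg_distrib,
    Real.exp_sum]
  rw [← Finset.prod_mul_distrib]
  refine Finset.prod_congr rfl fun i _ => ?_
  rw [pow_zero, one_mul, inv_mul_cancel_left₀ h2, ← Real.exp_add]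
  congr 1
  ring

theorem memLp_psi (hσ : 0 < σ) (x₀ : sparseSet N S) (x : EuclideanSpace ℝ (Fin N)) :
    MemLp (psi σ x₀.1 x) 2 (model N S σ x₀) := by
  rw [memLp_two_iff_integrable_sq (continuous_psi _ _ _).aestronglyMeasurable]
  rw [funext (psi_sq σ x₀.1 x)]
  exact (integrable_psi_sq_mul_prod hσ x₀
    fun i => integrable_hermiteFun_mul_exp 0 (2 * x i)).const_mul _

/-- Change of measure from `x` to `x₀`, for integrability. -/
theorem integrable_model_iff_mul_psi (hσ : 0 < σ) (x₀ x : sparseSet N S)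
    {h : EuclideanSpace ℝ (Fin N) → ℝ} : Integrable h (model N S σ x) ↔
      Integrable (fun y => h y * psi σ x₀.1 (σ⁻¹ • x.1) y) (model N S σ x₀) := by
  rw [integrable_model_iff hσ, integrable_model_iff hσ]
  refine Iff.trans (integrable_congr (Eventually.of_forall fun y => ?_))
    (integrable_const_mul_iff (c := (nu σ x₀.1 x.1)⁻¹) (inv_pos.2 (nu_pos _ _ _)).ne'.isUnit _)
  simp only [obsPdf_eq_mul_psi_div_nu hσ x₀.1 x.1 y]
  ring

/-- Change of measure from `x` to `x₀`. -/
theorem integral_model_eq_mul_psi (hσ : 0 < σ) (x₀ x : sparseSet N S)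
    (h : EuclideanSpace ℝ (Fin N) → ℝ) : ∫ y, h y ∂(model N S σ x) =
      1 / nu σ x₀.1 x.1 * ∫ y, h y * psi σ x₀.1 (σ⁻¹ • x.1) y ∂(model N S σ x₀) := by
  rw [integral_model hσ, integral_model hσ, ← integral_const_mul]
  refine integral_congr_ae (Eventually.of_forall fun y => ?_)
  simp only [obsPdf_eq_mul_psi_div_nu hσ x₀.1 x.1 y]
  ring

end HermiteSystem

end SSNM

/-! ### Orthonormal expansions and equality in Bessel's inequality -/

section OrthonormalExpansion

variable {H ι : Type*} [NormedAddCommGroup H] [InnerProductSpace ℝ H] {e : ι → H}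

theorem Orthonormal.summable_smul_of_summable_sq [CompleteSpace H] (he : Orthonormal ℝ e)
    {a : ι → ℝ} (ha : Summable fun p => a p ^ 2) : Summable fun p => a p • e p := by
  have h := (he.orthogonalFamily.summable_iff_norm_sq_summable (f := a)).2
    (by simpa using ha)
  simpa using h

theorem Orthonormal.inner_eq_of_hasSum (he : Orthonormal ℝ e) {a : ι → ℝ} {w : H}
    (h : HasSum (fun p => a p • e p) w) (p : ι) : inner ℝ (e p) w = a p := by
  have h1 := h.mapL (innerSL ℝ (e p))
  refine h1.unique ?_
  simp only [innerSL_apply_apply, real_inner_smul_right]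
  convert hasSum_single p fun q hq => ?_ using 1
  · simp [he.1 p]
  · rw [he.2 hq.symm, mul_zero]

theorem Orthonormal.hasSum_sq_of_hasSum (he : Orthonormal ℝ e) {a : ι → ℝ} {w : H}
    (h : HasSum (fun p => a p • e p) w) : HasSum (fun p => a p ^ 2) (‖w‖ ^ 2) := by
  have h1 := h.mapL (innerSL ℝ w)
  simp only [innerSL_apply_apply, real_inner_smul_right, real_inner_self_eq_norm_sq] at h1
  refine h1.congr_fun fun p => ?_
  rw [real_inner_comm, he.inner_eq_of_hasSum h, sq]

/-- A vector whose norm attains Bessel's bound is the sum of its orthonormal expansion. -/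
theorem Orthonormal.hasSum_smul_of_hasSum_sq [CompleteSpace H] (he : Orthonormal ℝ e) {v : H}
    (h : HasSum (fun p => inner ℝ (e p) v ^ 2) (‖v‖ ^ 2)) :
    HasSum (fun p => inner ℝ (e p) v • e p) v := by
  have hw := (he.summable_smul_of_summable_sq h.summable).hasSum
  set w := ∑' p, inner ℝ (e p) v • e p
  have h1 := (he.hasSum_sq_of_hasSum hw).unique h
  have h2 := hw.mapL (innerSL ℝ v)
  simp only [innerSL_apply_apply, real_inner_smul_right] at h2
  have h3 : inner ℝ v w = ‖v‖ ^ 2 := by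
    refine h2.unique ?_
    refine h.congr_fun fun p => ?_
    rw [real_inner_comm, sq]
  have h4 : ‖w - v‖ ^ 2 = 0 := by
    rw [norm_sub_sq_real, h1, real_inner_comm, h3]
    ring
  have h5 : w = v := by simpa [sub_eq_zero] using h4
  exact h5 ▸ hw

end OrthonormalExpansion

theorem MeasureTheory.MemLp.inner_toLp_toLp {α : Type*} [MeasurableSpace α] {μ : Measure α}
    {f g : α → ℝ} (hf : MemLp f 2 μ) (hg : MemLp g 2 μ) :
    inner ℝ (hf.toLp f) (hg.toLp g) = ∫ y, f y * g y ∂μ := by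
  rw [L2.inner_def]
  refine integral_congr_ae ?_
  filter_upwards [hf.coeFn_toLp, hg.coeFn_toLp] with y h1 h2
  rw [h1, h2]
  simp [mul_comm]

namespace SSNM

/-! ### Allowed estimators as elements of `L²` with prescribed coefficients -/

section Estimators

variable {N S : ℕ} {σ : ℝ}

/-- The `p`-th element of the Hermite system in `L²`. -/
noncomputable def hermiteLp (hσ : 0 < σ) (x₀ : sparseSet N S) (p : SparseIndex N S) :
    Lp ℝ 2 (model N S σ x₀) :=
  (memLp_hermiteSystem hσ x₀ p.1).toLp _

/-- The function `ψ_{x₀}(x, ·)` in `L²`. -/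
noncomputable def psiLp (hσ : 0 < σ) (x₀ : sparseSet N S) (x : EuclideanSpace ℝ (Fin N)) :
    Lp ℝ 2 (model N S σ x₀) :=
  (memLp_psi hσ x₀ x).toLp _

theorem orthonormal_hermiteLp (hσ : 0 < σ) (x₀ : sparseSet N S) :
    Orthonormal ℝ (hermiteLp hσ x₀) := by
  classical
  rw [orthonormal_iff_ite]
  intro p q
  rw [hermiteLp, hermiteLp, MemLp.inner_toLp_toLp, integral_hermiteSystem_mul hσ]
  simp [Subtype.ext_iff]

theorem mpow_eq_zero_of_mem_sparseSet {x : EuclideanSpace ℝ (Fin N)} (hx : x ∈ sparseSet N S)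
    {p : Fin N → ℕ} (hp : ¬ (msupp p).card ≤ S) : mpow x p = 0 := by
  by_contra h
  refine hp (le_trans (Finset.card_le_card fun i hi => ?_) hx)
  have hpi : p i ≠ 0 := by simpa [msupp] using hi
  have hxi : x i ≠ 0 := fun h0 =>
    h (Finset.prod_eq_zero (Finset.mem_univ i) (by rw [h0, zero_pow hpi]))
  simpa using hxi

theorem smul_mem_sparseSet {x : EuclideanSpace ℝ (Fin N)} (hx : x ∈ sparseSet N S) (t : ℝ) :
    t • x ∈ sparseSet N S := by
  refine le_trans (Finset.card_le_card fun i hi => ?_) hx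
  have hi' : t ≠ 0 ∧ x i ≠ 0 := by simpa [not_or] using hi
  simpa using hi'.2

/-- Expansion of `ψ_{x₀}(x, ·)` for sparse `x` in the Hermite system. -/
theorem hasSum_psiLp (hσ : 0 < σ) (x₀ : sparseSet N S) {x : EuclideanSpace ℝ (Fin N)}
    (hx : x ∈ sparseSet N S) :
    HasSum (fun p : SparseIndex N S => (mpow x p.1 / √(mfactorial p.1)) • hermiteLp hσ x₀ p)
      (psiLp hσ x₀ x) := by
  have hin : ∀ p : SparseIndex N S, inner ℝ (hermiteLp hσ x₀ p) (psiLp hσ x₀ x) =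
      mpow x p.1 / √(mfactorial p.1) := fun p => by
    rw [hermiteLp, psiLp, MemLp.inner_toLp_toLp, integral_hermiteSystem_mul_psi hσ]
  have hnorm : ‖psiLp hσ x₀ x‖ ^ 2 = Real.exp (‖x‖ ^ 2) := by
    rw [← real_inner_self_eq_norm_sq, psiLp, MemLp.inner_toLp_toLp, ← integral_psi_sq hσ x₀]
    simp only [sq]
  -- Equality in Bessel: the squared coefficients over all multi-indices sum to `exp ‖x‖²`, and for
  -- sparse `x` the non-sparse indices contribute nothing.
  have h := (orthonormal_hermiteLp hσ x₀).hasSum_smul_of_hasSum_sq (v := psiLp hσ x₀ x) (by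
    simp only [hin, hnorm, div_pow]
    have h1 : HasSum (fun p : {p : Fin N → ℕ | (msupp p).card ≤ S} =>
        mpow x p.1 ^ 2 / mfactorial p.1) (Real.exp (‖x‖ ^ 2)) := by
      refine (hasSum_subtype_iff_of_support_subset
        (f := fun p : Fin N → ℕ => mpow x p ^ 2 / mfactorial p) fun p hp => ?_).2
        (hasSum_mpow_sq_div_mfactorial x)
      by_contra hp'
      exact hp (by simp [mpow_eq_zero_of_mem_sparseSet hx hp'])
    refine h1.congr_fun fun p => ?_
    rw [Real.sq_sqrt (mfactorial_pos _).le])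
  simpa only [hin] using h

theorem hasSum_inner_psiLp (hσ : 0 < σ) (x₀ x : sparseSet N S) (v : Lp ℝ 2 (model N S σ x₀)) :
    HasSum (fun p : SparseIndex N S => inner ℝ (hermiteLp hσ x₀ p) v / √(mfactorial p.1) *
      mpow (σ⁻¹ • x.1) p.1) (inner ℝ v (psiLp hσ x₀ (σ⁻¹ • x.1))) := by
  have h := (hasSum_psiLp hσ x₀ (smul_mem_sparseSet x.2 σ⁻¹)).mapL (innerSL ℝ v)
  refine h.congr_fun fun p => ?_
  rw [innerSL_apply_apply, real_inner_smul_right, real_inner_comm v]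
  ring

/-- The likelihood ratio is itself square integrable, so finite variance at `x₀` already makes the
mean exist at every `x`. -/
theorem integrable_model_of_memLp (hσ : 0 < σ) {x₀ : sparseSet N S}
    {h : EuclideanSpace ℝ (Fin N) → ℝ} (hh : MemLp h 2 (model N S σ x₀)) (x : sparseSet N S) :
    Integrable h (model N S σ x) :=
  (integrable_model_iff_mul_psi hσ x₀ x).2 (hh.integrable_mul (memLp_psi hσ x₀ _))

theorem integral_model_eq_inner (hσ : 0 < σ) {x₀ : sparseSet N S}
    {h : EuclideanSpace ℝ (Fin N) → ℝ} (hh : MemLp h 2 (model N S σ x₀)) (x : sparseSet N S) :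
    ∫ y, h y ∂(model N S σ x) =
      1 / nu σ x₀.1 x.1 * inner ℝ (hh.toLp h) (psiLp hσ x₀ (σ⁻¹ • x.1)) := by
  rw [integral_model_eq_mul_psi hσ x₀ x, psiLp, MemLp.inner_toLp_toLp]

variable {g c γ : sparseSet N S → ℝ} {x₀ : sparseSet N S}

/-- The allowed estimators are the square-integrable ones whose Hermite coefficients represent the
prescribed mean function. -/
theorem mem_allowedEstimators_iff (hσ : 0 < σ) (hγ : ∀ x, γ x = c x + g x)
    {h : EuclideanSpace ℝ (Fin N) → ℝ} :
    h ∈ MVE.allowedEstimators (model N S σ) g c x₀ ↔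
      Measurable h ∧ ∃ hh : MemLp h 2 (model N S σ x₀),
        IsCoeffSeq σ x₀ γ fun p => inner ℝ (hermiteLp hσ x₀ p) (hh.toLp h) := by
  have := isProbabilityMeasure_model hσ x₀
  have hmean : ∀ x, (∫ y, h y ∂(model N S σ x)) - g x = c x ↔
      γ x = ∫ y, h y ∂(model N S σ x) := fun x => by
    rw [hγ x, sub_eq_iff_eq_add, eq_comm]
  constructor
  · rintro ⟨hm, hv, hb⟩
    have hh := (evariance_lt_top_iff_memLp hm.aestronglyMeasurable).1 hv
    refine ⟨hm, hh, ?_, fun x => ?_⟩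
    · simpa using (orthonormal_hermiteLp hσ x₀).inner_products_summable (hh.toLp h)
    · have hs := hasSum_inner_psiLp hσ x₀ x (hh.toLp h)
      refine ⟨hs.summable, ?_⟩
      rw [hs.tsum_eq, (hmean x).1 (hb x).2, integral_model_eq_inner hσ hh]
  · rintro ⟨hm, hh, -, hb⟩
    refine ⟨hm, evariance_lt_top hh, fun x => ⟨integrable_model_of_memLp hσ hh x, ?_⟩⟩
    rw [hmean, integral_model_eq_inner hσ hh, (hb x).2,
      (hasSum_inner_psiLp hσ x₀ x (hh.toLp h)).tsum_eq]

theorem evariance_eq_of_mem_allowedEstimators (hσ : 0 < σ) (hγ : ∀ x, γ x = c x + g x)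
    {h : EuclideanSpace ℝ (Fin N) → ℝ} (ha : h ∈ MVE.allowedEstimators (model N S σ) g c x₀)
    (hh : MemLp h 2 (model N S σ x₀)) :
    evariance h (model N S σ x₀) = ENNReal.ofReal (‖hh.toLp h‖ ^ 2 - γ x₀ ^ 2) ∧
      0 ≤ ‖hh.toLp h‖ ^ 2 - γ x₀ ^ 2 := by
  have := isProbabilityMeasure_model hσ x₀
  have h1 : ∫ y, h y ∂(model N S σ x₀) = γ x₀ := by
    rw [hγ, ← (ha.2.2 x₀).2, sub_add_cancel]
  have h2 : variance h (model N S σ x₀) = ‖hh.toLp h‖ ^ 2 - γ x₀ ^ 2 := by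
    rw [variance_eq_sub hh, h1, ← real_inner_self_eq_norm_sq, MemLp.inner_toLp_toLp]
    simp only [Pi.pow_apply, sq]
  rw [← h2]
  exact ⟨(ofReal_variance hh).symm, variance_nonneg _ _⟩

theorem coeff_eq (hσ : 0 < σ) {a : SparseIndex N S → ℝ} (ha : IsCoeffSeq σ x₀ γ a) :
    coeff σ x₀ γ = a :=
  funext fun p => (contDiff_scaledMean_and_coeff_eq hσ ha p).2

theorem memLp_sum_lmvTerm (hσ : 0 < σ) (x₀ : sparseSet N S) (γ : sparseSet N S → ℝ)
    (s : Finset (SparseIndex N S)) :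
    MemLp (fun y => ∑ p ∈ s, lmvTerm σ x₀ γ p y) 2 (model N S σ x₀) := by
  simp only [lmvTerm_eq]
  exact memLp_finsetSum s fun p _ => (memLp_hermiteSystem hσ x₀ p.1).const_mul _

theorem toLp_sum_lmvTerm (hσ : 0 < σ) (x₀ : sparseSet N S) (γ : sparseSet N S → ℝ)
    (s : Finset (SparseIndex N S)) :
    (memLp_sum_lmvTerm hσ x₀ γ s).toLp _ = ∑ p ∈ s, coeff σ x₀ γ p • hermiteLp hσ x₀ p := by
  classical
  induction s using Finset.induction_on with
  | empty =>
    simp only [Finset.sum_empty]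
    exact MemLp.toLp_zero _
  | insert p s hp ih =>
    rw [Finset.sum_insert hp, ← ih, hermiteLp, ← MemLp.toLp_const_smul, ← MemLp.toLp_add]
    refine MemLp.toLp_congr _ _ (Eventually.of_forall fun y => ?_)
    simp [Finset.sum_insert hp, lmvTerm_eq]

/-- Mean-square convergence of the estimator series to `h`, as a sum in `L²`. -/
theorem tendsto_eLpNorm_sum_lmvTerm_iff (hσ : 0 < σ) {h : EuclideanSpace ℝ (Fin N) → ℝ}
    (hh : MemLp h 2 (model N S σ x₀)) :
    Tendsto (fun s : Finset (SparseIndex N S) =>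
      eLpNorm (fun y => (∑ p ∈ s, lmvTerm σ x₀ γ p y) - h y) 2 (model N S σ x₀)) atTop (𝓝 0) ↔
    HasSum (fun p => coeff σ x₀ γ p • hermiteLp hσ x₀ p) (hh.toLp h) := by
  have h1 := Lp.tendsto_Lp_iff_tendsto_eLpNorm'' (fi := atTop)
    (fun (s : Finset (SparseIndex N S)) y => ∑ p ∈ s, lmvTerm σ x₀ γ p y)
    (memLp_sum_lmvTerm hσ x₀ γ) h hh
  simp only [toLp_sum_lmvTerm hσ] at h1
  exact h1.symm

/-- A single partial sum at finite distance from `h` suffices, because partial sums are square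
integrable. -/
theorem memLp_of_tendsto_eLpNorm (hσ : 0 < σ) {h : EuclideanSpace ℝ (Fin N) → ℝ}
    (hm : Measurable h) (ht : Tendsto (fun s : Finset (SparseIndex N S) =>
      eLpNorm (fun y => (∑ p ∈ s, lmvTerm σ x₀ γ p y) - h y) 2 (model N S σ x₀)) atTop (𝓝 0)) :
    MemLp h 2 (model N S σ x₀) := by
  obtain ⟨s, hs⟩ := (ht.eventually (gt_mem_nhds ENNReal.zero_lt_top)).exists
  have hsum := memLp_sum_lmvTerm hσ x₀ γ s
  have hd : MemLp (fun y => (∑ p ∈ s, lmvTerm σ x₀ γ p y) - h y) 2 (model N S σ x₀) :=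
    ⟨hsum.1.sub hm.aestronglyMeasurable, hs⟩
  refine (hsum.sub hd).ae_eq (Eventually.of_forall fun y => ?_)
  simp

/-- A square-integrable measurable function whose class is the sum of the coefficient series is
an allowed estimator. -/
theorem mem_allowedEstimators_of_hasSum (hσ : 0 < σ) (hγ : ∀ x, γ x = c x + g x)
    {a : SparseIndex N S → ℝ} (ha : IsCoeffSeq σ x₀ γ a) {h : EuclideanSpace ℝ (Fin N) → ℝ}
    (hm : Measurable h) (hh : MemLp h 2 (model N S σ x₀))
    (hs : HasSum (fun p => a p • hermiteLp hσ x₀ p) (hh.toLp h)) :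
    h ∈ MVE.allowedEstimators (model N S σ) g c x₀ := by
  refine (mem_allowedEstimators_iff hσ hγ).2 ⟨hm, hh, ?_⟩
  simpa only [(orthonormal_hermiteLp hσ x₀).inner_eq_of_hasSum hs] using ha

/-- Estimators are measurable functions rather than classes, so the `L²` sum is replaced by a
measurable representative. -/
theorem exists_measurable_hasSum (hσ : 0 < σ) {a : SparseIndex N S → ℝ}
    (ha : Summable fun p => a p ^ 2) :
    ∃ (h : EuclideanSpace ℝ (Fin N) → ℝ) (hh : MemLp h 2 (model N S σ x₀)), Measurable h ∧
      HasSum (fun p => a p • hermiteLp hσ x₀ p) (hh.toLp h) := by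
  have hw := ((orthonormal_hermiteLp hσ x₀).summable_smul_of_summable_sq ha).hasSum
  set w := ∑' p, a p • hermiteLp hσ x₀ p
  have hwm := Lp.aestronglyMeasurable w
  refine ⟨hwm.mk w, (Lp.memLp w).ae_eq hwm.ae_eq_mk, hwm.stronglyMeasurable_mk.measurable, ?_⟩
  rwa [MemLp.toLp_congr ((Lp.memLp w).ae_eq hwm.ae_eq_mk) (Lp.memLp w) hwm.ae_eq_mk.symm,
    Lp.toLp_coeFn]

theorem isValidBias_iff (hσ : 0 < σ) (hγ : ∀ x, γ x = c x + g x) :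
    MVE.IsValidBias (model N S σ) g c x₀ ↔ ∃ a, IsCoeffSeq σ x₀ γ a := by
  constructor
  · rintro ⟨h, hmem⟩
    obtain ⟨-, hh, ha⟩ := (mem_allowedEstimators_iff hσ hγ).1 hmem
    exact ⟨_, ha⟩
  · rintro ⟨a, ha⟩
    obtain ⟨h, hh, hm, hs⟩ := exists_measurable_hasSum (x₀ := x₀) hσ ha.1
    exact ⟨h, mem_allowedEstimators_of_hasSum hσ hγ ha hm hh hs⟩

/-- The Barankin bound, and the estimators that attain it. -/
theorem minVariance_eq_and_isLMV_iff (hσ : 0 < σ) (hγ : ∀ x, γ x = c x + g x)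
    {a : SparseIndex N S → ℝ} (ha : IsCoeffSeq σ x₀ γ a) :
    (MVE.minVariance (model N S σ) g c x₀ = ENNReal.ofReal ((∑' p, a p ^ 2) - γ x₀ ^ 2) ∧
      0 ≤ (∑' p, a p ^ 2) - γ x₀ ^ 2) ∧
    ∀ h, MVE.IsLMV (model N S σ) g c x₀ h ↔ Measurable h ∧
      ∃ hh : MemLp h 2 (model N S σ x₀),
        HasSum (fun p => a p • hermiteLp hσ x₀ p) (hh.toLp h) := by
  have he := orthonormal_hermiteLp hσ x₀
  -- By uniqueness of the coefficient sequence, all allowed estimators have the same projections on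
  -- the Hermite system.
  have inner_eq : ∀ {h : EuclideanSpace ℝ (Fin N) → ℝ}
      (_ : h ∈ MVE.allowedEstimators (model N S σ) g c x₀) (hh : MemLp h 2 (model N S σ x₀))
      (p : SparseIndex N S), inner ℝ (hermiteLp hσ x₀ p) (hh.toLp h) = a p := by
    intro h hmem hh p
    obtain ⟨-, _, hc⟩ := (mem_allowedEstimators_iff hσ hγ).1 hmem
    exact congrFun ((coeff_eq hσ hc).symm.trans (coeff_eq hσ ha)) p
  have memLp : ∀ {h : EuclideanSpace ℝ (Fin N) → ℝ}
      (_ : h ∈ MVE.allowedEstimators (model N S σ) g c x₀), MemLp h 2 (model N S σ x₀) :=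
    fun hmem => ((mem_allowedEstimators_iff hσ hγ).1 hmem).2.choose
  have evar : ∀ {h : EuclideanSpace ℝ (Fin N) → ℝ} (_ : Measurable h)
      (hh : MemLp h 2 (model N S σ x₀))
      (_ : HasSum (fun p => a p • hermiteLp hσ x₀ p) (hh.toLp h)),
      evariance h (model N S σ x₀) = ENNReal.ofReal ((∑' p, a p ^ 2) - γ x₀ ^ 2) ∧
        0 ≤ (∑' p, a p ^ 2) - γ x₀ ^ 2 := by
    intro h hm hh hs
    rw [(he.hasSum_sq_of_hasSum hs).tsum_eq]
    exact evariance_eq_of_mem_allowedEstimators hσ hγ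
      (mem_allowedEstimators_of_hasSum hσ hγ ha hm hh hs) hh
  obtain ⟨h₀, hh₀, hm₀, hs₀⟩ := exists_measurable_hasSum (x₀ := x₀) hσ ha.1
  have hmin : MVE.minVariance (model N S σ) g c x₀ =
      ENNReal.ofReal ((∑' p, a p ^ 2) - γ x₀ ^ 2) := by
    refine le_antisymm ?_ (le_iInf₂ fun h hmem => ?_)
    · rw [← (evar hm₀ hh₀ hs₀).1]
      exact iInf₂_le h₀ (mem_allowedEstimators_of_hasSum hσ hγ ha hm₀ hh₀ hs₀)
    · rw [(evariance_eq_of_mem_allowedEstimators hσ hγ hmem (memLp hmem)).1]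
      refine ENNReal.ofReal_le_ofReal (sub_le_sub_right ?_ _)
      -- Bessel's inequality is the lower bound on the variance, as the mean at `x₀` is fixed.
      have hB := he.tsum_inner_products_le ((memLp hmem).toLp h)
      simpa only [inner_eq hmem, Real.norm_eq_abs, sq_abs] using hB
  refine ⟨⟨hmin, (evar hm₀ hh₀ hs₀).2⟩, fun h => ⟨fun ⟨hmem, hv⟩ => ?_, fun ⟨hm, hh, hs⟩ => ?_⟩⟩
  · have hh := memLp hmem
    refine ⟨hmem.1, hh, ?_⟩
    have h1 := evariance_eq_of_mem_allowedEstimators hσ hγ hmem hh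
    -- Both differences are nonnegative, so `ENNReal.ofReal` loses nothing: minimal variance means
    -- equality in Bessel, which forces `h` to be the sum of its expansion.
    rw [h1.1, hmin, ENNReal.ofReal_eq_ofReal_iff h1.2 (evar hm₀ hh₀ hs₀).2, sub_left_inj] at hv
    have h2 := he.hasSum_smul_of_hasSum_sq (v := hh.toLp h) (by
      simp only [inner_eq hmem hh]
      rw [hv]
      exact ha.1.hasSum)
    simpa only [inner_eq hmem hh] using h2
  · exact ⟨mem_allowedEstimators_of_hasSum hσ hγ ha hm hh hs, by rw [(evar hm hh hs).1, hmin]⟩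

end Estimators

end SSNM

/-! ### Main theorem -/

theorem theorem10 (N S : ℕ) (hS : 1 ≤ S) (hSN : S ≤ N) (σ : ℝ) (hσ : 0 < σ)
    (g c : SSNM.sparseSet N S → ℝ) (x₀ : SSNM.sparseSet N S)
    (γ : SSNM.sparseSet N S → ℝ) (hγ : ∀ x, γ x = c x + g x) :
    -- validity of the bias function, and uniqueness of the coefficient sequence
    ((MVE.IsValidBias (SSNM.model N S σ) g c x₀ ↔
        ∃ a : SSNM.SparseIndex N S → ℝ, SSNM.IsCoeffSeq σ x₀ γ a) ∧
      (∀ a a' : SSNM.SparseIndex N S → ℝ,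
        SSNM.IsCoeffSeq σ x₀ γ a → SSNM.IsCoeffSeq σ x₀ γ a' → a = a')) ∧
    (MVE.IsValidBias (SSNM.model N S σ) g c x₀ →
      -- the derivatives that define the coefficients exist
      (∀ p : SSNM.SparseIndex N S, ContDiff ℝ ∞ (SSNM.scaledMean σ x₀ γ p)) ∧
      -- the minimum achievable variance
      ((Summable fun p : SSNM.SparseIndex N S => SSNM.coeff σ x₀ γ p ^ 2) ∧
        ((MVE.minVariance (SSNM.model N S σ) g c x₀ : ℝ≥0∞) : EReal) =
          (((∑' p : SSNM.SparseIndex N S, SSNM.coeff σ x₀ γ p ^ 2) - γ x₀ ^ 2 : ℝ) : EReal)) ∧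
      -- the LMV estimator: it exists, and it is the mean-square sum of the series
      ((∃ h, MVE.IsLMV (SSNM.model N S σ) g c x₀ h) ∧
        ∀ h : EuclideanSpace ℝ (Fin N) → ℝ,
          MVE.IsLMV (SSNM.model N S σ) g c x₀ h ↔
            Measurable h ∧
              Tendsto (fun s : Finset (SSNM.SparseIndex N S) =>
                eLpNorm (fun y => (∑ p ∈ s, SSNM.lmvTerm σ x₀ γ p y) - h y) 2
                  (SSNM.model N S σ x₀)) atTop (𝓝 0))) := by
  refine ⟨⟨SSNM.isValidBias_iff hσ hγ, fun a a' ha ha' =>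
    (SSNM.coeff_eq hσ ha).symm.trans (SSNM.coeff_eq hσ ha')⟩, fun hvalid => ?_⟩
  obtain ⟨a, ha⟩ := (SSNM.isValidBias_iff hσ hγ).1 hvalid
  have hcoeff := SSNM.coeff_eq hσ ha
  obtain ⟨⟨hmin, hnonneg⟩, hLMV⟩ := SSNM.minVariance_eq_and_isLMV_iff hσ hγ ha
  refine ⟨fun p => (SSNM.contDiff_scaledMean_and_coeff_eq hσ ha p).1, ⟨?_, ?_⟩, ?_, fun h => ?_⟩
  · simpa only [hcoeff] using ha.1
  -- Comparing in `EReal` avoids truncation at zero in the statement; `hnonneg` removes the `max`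
  -- that the coercion produces.
  · rw [hmin, EReal.coe_ennreal_ofReal, max_eq_left hnonneg, hcoeff]
  · obtain ⟨h, hh, hm, hs⟩ := SSNM.exists_measurable_hasSum (x₀ := x₀) hσ ha.1
    exact ⟨h, (hLMV h).2 ⟨hm, hh, hs⟩⟩
  · rw [hLMV h, ← hcoeff]
    refine and_congr_right fun hm => ⟨fun ⟨hh, hs⟩ => ?_, fun ht => ?_⟩
    · exact (SSNM.tendsto_eLpNorm_sum_lmvTerm_iff hσ hh).2 hs
    · have hh := SSNM.memLp_of_tendsto_eLpNorm hσ hm ht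
      exact ⟨hh, (SSNM.tendsto_eLpNorm_sum_lmvTerm_iff hσ hh).1 ht⟩
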